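/- Let $n\ge 1$, and let $L^0(\mathbb{R}^n)$ be the space of (real- or complex-valued) Lebesgue measurable functions on $\mathbb{R}^n$, modulo equality almost everywhere. A Banach function space over $\mathbb{R}^n$ is a vector space $X\subseteq L^0(\mathbb{R}^n)$ with a norm $\|\cdot\|_X$ such that (ideal property) if $f\in X$, $g\in L^0(\mathbb{R}^n)$ and $|g|\le|f|$ a.e., then $g\in X$ and $\|g\|_X\le\|f\|_X$; (Fatou property) if $f_j\in X$, $0\le f_j\uparrow f$ a.e. with $f\in L^0(\mathbb{R}^n)$, and $\sup_j\|f_j\|_X<\infty$, then $f\in X$ and $\|f\|_X=\sup_j\|f_j\|_X$; (saturation property) every measurable set $E$ of positive measure has a measurable subset $F\subseteq E$ of positive measure with $\chi_F\in X$. The associate space $X'$ consists of all $f\in L^0(\mathbb{R}^n)$ with $\|f\|_{X'}:=\sup_{\|g\|_X\le 1}\int_{\mathbb{R}^n}|fg|<\infty$. Below, $Q$ runs over the cubes in $\mathbb{R}^n$ with sides parallel to the axes, and $$Mf(x)=\sup_{Q\ni x}\frac1{|Q|}\int_Q|f|,\qquad m_\lambda f(x)=\sup_{Q\ni x}(f\chi_Q)^*(\lambda|Q|),\quad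 \lambda\in(0,1),$$ where $g^*(t)=\inf\{\alpha>0:|\{|g|>\alpha\}|\le t\}$ is the non-increasing rearrangement. For a space $Y\subseteq L^0(\mathbb{R}^n)$ with a norm, $M$ is bounded on $Y$ if there is a constant $C$ with $Mf\in Y$ and $\|Mf\|_Y\le C\|f\|_Y$ for all $f\in Y$. Finally, let $$\varphi_X(\lambda)=\inf_{\|f\|_X=1}\|m_\lambda f\|_X,\quad\lambda\in(0,1),$$ where $\|u\|_X:=\infty$ if $u\notin X$. **Theorem 1.2.** Let $X$ be a Banach function space over $\mathbb{R}^n$, and assume that $M$ is bounded on $X$. The following statements are equivalent: (i) $M$ is bounded on $X'$; (ii) the function $\varphi_X$ is unbounded on $(0,1)$; (iii) there exists $\lambda_0\in(0,1)$ such that $\varphi_X(\lambda_0)>1$. -/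

import Mathlib

open MeasureTheory Filter Topology
open scoped ENNReal NNReal ComplexOrder

/-- `L⁰(ℝⁿ)`: measurable `𝕜`-valued functions on `ℝⁿ` modulo equality Lebesgue-almost everywhere. -/
abbrev LZero (n : ℕ) (𝕜 : Type*) [RCLike 𝕜] : Type _ :=
  (Fin n → ℝ) →ₘ[(volume : Measure (Fin n → ℝ))] 𝕜

/-- A linear subspace of `L⁰(ℝⁿ)` equipped with a seminorm. -/
structure FunctionSpace (n : ℕ) (𝕜 : Type*) [RCLike 𝕜] where
  /-- the elements of the space -/
  carrier : Submodule 𝕜 (LZero n 𝕜)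
  /-- the (semi)norm of the space -/
  norm : Seminorm 𝕜 carrier

namespace FunctionSpace

variable {n : ℕ} {𝕜 : Type*} [RCLike 𝕜]

/-- `X` is a Banach function space over `ℝⁿ`: the seminorm is a norm, and the ideal property, the
Fatou property and the saturation property hold. -/
structure IsBanachFunctionSpace (X : FunctionSpace n 𝕜) : Prop where
  /-- the seminorm is a norm -/
  eq_zero_of_norm_eq_zero : ∀ f : X.carrier, X.norm f = 0 → f = 0
  /-- if `f ∈ X` and `|g| ≤ |f|` then `g ∈ X` and `‖g‖ ≤ ‖f‖` -/
  ideal : ∀ (f : X.carrier) (g : LZero n 𝕜), (∀ᵐ x, ‖g x‖ ≤ ‖(f : LZero n 𝕜) x‖) →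
    ∃ hg : g ∈ X.carrier, X.norm ⟨g, hg⟩ ≤ X.norm f
  /-- if `0 ≤ f j ↑ F` with `f j ∈ X` and `sup ‖f j‖ < ∞` then `F ∈ X` and `‖F‖ = sup ‖f j‖` -/
  fatou : ∀ (f : ℕ → X.carrier) (F : LZero n 𝕜),
    (∀ᵐ x, (∀ j, 0 ≤ (f j : LZero n 𝕜) x) ∧ Monotone (fun j => (f j : LZero n 𝕜) x) ∧
      Tendsto (fun j => (f j : LZero n 𝕜) x) atTop (𝓝 (F x))) →
    BddAbove (Set.range fun j => X.norm (f j)) →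
    ∃ hF : F ∈ X.carrier, X.norm ⟨F, hF⟩ = ⨆ j, X.norm (f j)
  /-- every set of positive measure contains a subset of positive measure whose characteristic
  function is in `X` -/
  saturation : ∀ E : Set (Fin n → ℝ), MeasurableSet E → 0 < volume E →
    ∃ F : Set (Fin n → ℝ), F ⊆ E ∧ MeasurableSet F ∧ 0 < volume F ∧
      ∃ h ∈ X.carrier, ∀ᵐ x, h x = F.indicator (fun _ => (1 : 𝕜)) x

/-- The norm of an `[0, ∞]`-valued function `u` in the function space `X`: it is `‖h‖` if
`u = |h|` a.e. with `h ∈ X`, and `∞` if `u` is not (a.e. equal to) the modulus of an element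
of `X`. -/
noncomputable def extNorm (X : FunctionSpace n 𝕜) (u : (Fin n → ℝ) → ℝ≥0∞) : ℝ≥0∞ :=
  ⨅ (h : X.carrier) (_ : ∀ᵐ x, u x = ‖(h : LZero n 𝕜) x‖ₑ), ENNReal.ofReal (X.norm h)

/-- `sup { ∫ |f g| : g ∈ X, ‖g‖ ≤ 1 }` -/
noncomputable def assocENorm (X : FunctionSpace n 𝕜) (f : LZero n 𝕜) : ℝ≥0∞ :=
  ⨆ (g : X.carrier) (_ : X.norm g ≤ 1), ∫⁻ x, ‖f x * (g : LZero n 𝕜) x‖ₑ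

theorem assocENorm_zero (X : FunctionSpace n 𝕜) : X.assocENorm 0 = 0 := by
  simp only [assocENorm, ENNReal.iSup_eq_zero]
  intro g _
  rw [lintegral_eq_zero_iff' (by fun_prop)]
  filter_upwards [AEEqFun.coeFn_zero (μ := (volume : Measure (Fin n → ℝ))) (β := 𝕜)] with x hx
  simp [hx]

theorem assocENorm_add_le (X : FunctionSpace n 𝕜) (f₁ f₂ : LZero n 𝕜) :
    X.assocENorm (f₁ + f₂) ≤ X.assocENorm f₁ + X.assocENorm f₂ := by
  refine iSup₂_le fun g hg => ?_
  calc ∫⁻ x, ‖(f₁ + f₂ : LZero n 𝕜) x * (g : LZero n 𝕜) x‖ₑ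
      ≤ ∫⁻ x, (‖f₁ x * (g : LZero n 𝕜) x‖ₑ + ‖f₂ x * (g : LZero n 𝕜) x‖ₑ) := by
        refine lintegral_mono_ae ?_
        filter_upwards [AEEqFun.coeFn_add f₁ f₂] with x hx
        rw [hx, Pi.add_apply, add_mul]
        exact enorm_add_le _ _
    _ = (∫⁻ x, ‖f₁ x * (g : LZero n 𝕜) x‖ₑ) + ∫⁻ x, ‖f₂ x * (g : LZero n 𝕜) x‖ₑ :=
        lintegral_add_left' (by fun_prop) _
    _ ≤ _ := add_le_add
        (le_iSup₂ (f := fun (g : X.carrier) (_ : X.norm g ≤ 1) =>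
          ∫⁻ x, ‖f₁ x * (g : LZero n 𝕜) x‖ₑ) g hg)
        (le_iSup₂ (f := fun (g : X.carrier) (_ : X.norm g ≤ 1) =>
          ∫⁻ x, ‖f₂ x * (g : LZero n 𝕜) x‖ₑ) g hg)

theorem assocENorm_smul (X : FunctionSpace n 𝕜) (c : 𝕜) (f : LZero n 𝕜) :
    X.assocENorm (c • f) = ‖c‖ₑ * X.assocENorm f := by
  simp only [assocENorm, ENNReal.mul_iSup]
  refine iSup_congr fun g => iSup_congr fun _ => ?_
  rw [← lintegral_const_mul' _ _ enorm_ne_top]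
  refine lintegral_congr_ae ?_
  filter_upwards [AEEqFun.coeFn_smul c f] with x hx
  rw [hx, Pi.smul_apply, smul_eq_mul, mul_assoc, enorm_mul]

/-- The associate space (Köthe dual) `X'` of `X`: all `f ∈ L⁰` with
`‖f‖ = sup { ∫ |f g| : ‖g‖_X ≤ 1 } < ∞`. -/
noncomputable def associate (X : FunctionSpace n 𝕜) : FunctionSpace n 𝕜 where
  carrier :=
    { carrier := {f | X.assocENorm f < ∞}
      zero_mem' := by simp [assocENorm_zero]
      add_mem' := fun {a b} ha hb =>
        (X.assocENorm_add_le a b).trans_lt (ENNReal.add_lt_top.2 ⟨ha, hb⟩)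
      smul_mem' := fun c f hf => by
        simp only [Set.mem_ofPred_eq, assocENorm_smul]
        exact ENNReal.mul_lt_top enorm_lt_top hf }
  norm := Seminorm.of (fun f => (X.assocENorm f).toReal)
    (fun f₁ f₂ => by
      rw [← ENNReal.toReal_add f₁.2.ne f₂.2.ne]
      exact ENNReal.toReal_mono (ENNReal.add_ne_top.2 ⟨f₁.2.ne, f₂.2.ne⟩)
        (X.assocENorm_add_le f₁ f₂))
    (fun c f => by
      rw [Submodule.coe_smul, assocENorm_smul, ENNReal.toReal_mul, toReal_enorm])

end FunctionSpace

/-- The closed cube in `ℝⁿ` with sides parallel to the axes, lower corner `a` and side length `l`. -/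
def cube {n : ℕ} (a : Fin n → ℝ) (l : ℝ) : Set (Fin n → ℝ) :=
  Set.Icc a (fun i => a i + l)

/-- The Hardy–Littlewood maximal function `Mf(x) = sup_{Q ∋ x} |Q|⁻¹ ∫_Q |f|`, over all cubes `Q`
containing `x`. -/
noncomputable def hlMaximal {n : ℕ} {𝕜 : Type*} [RCLike 𝕜] (f : (Fin n → ℝ) → 𝕜)
    (x : Fin n → ℝ) : ℝ≥0∞ :=
  ⨆ (a : Fin n → ℝ) (l : ℝ) (_ : 0 < l) (_ : x ∈ cube a l),
    (volume (cube a l))⁻¹ * ∫⁻ y in cube a l, ‖f y‖ₑ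

/-- The non-increasing rearrangement `f^*(t) = inf {α > 0 : |{|f| > α}| ≤ t}`. -/
noncomputable def rearrangement {n : ℕ} {𝕜 : Type*} [RCLike 𝕜] (f : (Fin n → ℝ) → 𝕜)
    (t : ℝ≥0∞) : ℝ≥0∞ :=
  ⨅ (α : ℝ≥0∞) (_ : 0 < α) (_ : volume {x | α < ‖f x‖ₑ} ≤ t), α

/-- The local maximal function `m_lam f(x) = sup_{Q ∋ x} (f χ_Q)^*(lam |Q|)`, over all cubes `Q`
containing `x`. -/
noncomputable def localMaximal {n : ℕ} {𝕜 : Type*} [RCLike 𝕜] (lam : ℝ) (f : (Fin n → ℝ) → 𝕜)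
    (x : Fin n → ℝ) : ℝ≥0∞ :=
  ⨆ (a : Fin n → ℝ) (l : ℝ) (_ : 0 < l) (_ : x ∈ cube a l),
    rearrangement ((cube a l).indicator f) (ENNReal.ofReal lam * volume (cube a l))

namespace FunctionSpace

variable {n : ℕ} {𝕜 : Type*} [RCLike 𝕜]

/-- The Hardy–Littlewood maximal operator is bounded on `X`: there is a constant `C` such that
`Mf ∈ X` and `‖Mf‖ ≤ C ‖f‖` for all `f ∈ X`. -/
def MaximalBounded (X : FunctionSpace n 𝕜) : Prop :=
  ∃ C : ℝ≥0, ∀ f : X.carrier,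
    X.extNorm (hlMaximal (f : LZero n 𝕜)) ≤ C * ENNReal.ofReal (X.norm f)

/-- `φ_X(lam) = inf { ‖m_lam f‖_X : ‖f‖_X = 1 }`. -/
noncomputable def phi (X : FunctionSpace n 𝕜) (lam : ℝ) : ℝ≥0∞ :=
  ⨅ (f : X.carrier) (_ : X.norm f = 1), X.extNorm (localMaximal lam (f : LZero n 𝕜))

end FunctionSpace

/-! Cubes are closed sup-norm balls, so everything is phrased with balls. Write `m_t` for the local
maximal operator and `E = {u > β}`. Then `m_t u(x) > β` means that some ball containing `x` meets
`E` in more than the fraction `t` of its volume.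

(iii) ⇒ (ii): a Vitali covering gives `m_t (m_t u) ≤ m_s u` with `s = t² 15⁻ⁿ`
(`ballLocMax_ballLocMax_le`). Hence a lower bound `κ > 1` for `φ_X` at one point becomes `κ²`, `κ⁴`,
... at smaller points.

(ii) ⇒ (i): up to dimensional constants `Mg` is a supremum of averages over countably many balls
`B_k`. A finite supremum is linearized by disjoint sets `E_k ⊆ B_k` on which the `k`-th average is
the largest. The adjoint of this linearization is `Tf = ∑ |B_k|⁻¹ (∫_{E_k} f) χ_{B_k}`. The
pointwise bound `m_t(Tf) ≤ 3ⁿ M(Tf) + t⁻¹ 3ⁿ Mf` (`ballLocMax_ballSum_le`), together with `φ_X(t) >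
2·3ⁿ ‖M‖`, lets the term `M(Tf)` be absorbed. So the operators `T` are bounded on `X` uniformly in
the family, and by duality `M` is bounded on `X'`.

(i) ⇒ (ii): the Rubio de Francia series gives each `g` in the unit ball of `X'` an `A₁` majorant
`G`, with an `A₁` constant depending only on the norm of `M` on `X'`. For an `A₁` weight a
stopping-radius and covering argument gives `(1 + ε) ∫ u G ≤ ∫ (m_t u) G`
(`lintegral_mul_le_lintegral_ballLocMax_mul`). Iterating with the composition bound replaces `1 + ε`
by an arbitrarily large constant. Choosing `g` to nearly norm `u`, which the Lorentz–Luxemburg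
theorem allows, turns this into a lower bound for `‖m_t u‖_X`. -/

/-! ### Maximal functions over closed sup-norm balls -/

section Balls

open Metric

variable {n : ℕ}

theorem volume_closedBall_mul (c c' : Fin n → ℝ) {k r : ℝ} (hk : 0 ≤ k) (hr : 0 ≤ r) :
    volume (closedBall c (k * r)) = ENNReal.ofReal k ^ n * volume (closedBall c' r) := by
  rw [Real.volume_pi_closedBall _ (mul_nonneg hk hr), Real.volume_pi_closedBall _ hr,
    ← ENNReal.ofReal_pow hk, ← ENNReal.ofReal_mul (pow_nonneg hk _), Fintype.card_fin, ← mul_pow]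
  congr 2
  ring

theorem volume_closedBall_ofNat_mul (c c' : Fin n → ℝ) (k : ℕ) {r : ℝ} (hr : 0 ≤ r) :
    volume (closedBall c (k * r)) = (k : ℝ≥0∞) ^ n * volume (closedBall c' r) := by
  rw [volume_closedBall_mul c c' k.cast_nonneg hr, ENNReal.ofReal_natCast]

theorem volume_closedBall_pos (c : Fin n → ℝ) {r : ℝ} (hr : 0 < r) :
    volume (closedBall c r) ≠ 0 :=
  (measure_closedBall_pos _ _ hr).ne'

theorem volume_closedBall_ne_top (c : Fin n → ℝ) (r : ℝ) : volume (closedBall c r) ≠ ∞ :=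
  measure_closedBall_lt_top.ne

theorem tendsto_volume_closedBall (c : Fin n → ℝ) {r : ℝ} (hr : 0 < r) :
    Tendsto (fun s => volume (closedBall c s)) (𝓝 r) (𝓝 (volume (closedBall c r))) := by
  have h : Tendsto (fun s : ℝ => ENNReal.ofReal ((2 * s) ^ Fintype.card (Fin n))) (𝓝 r)
      (𝓝 (ENNReal.ofReal ((2 * r) ^ Fintype.card (Fin n)))) := by
    apply ENNReal.tendsto_ofReal
    exact (Continuous.tendsto (by fun_prop) r)
  rw [Real.volume_pi_closedBall _ hr.le]
  refine h.congr' ?_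
  filter_upwards [lt_mem_nhds hr] with s hs
  rw [Real.volume_pi_closedBall _ hs.le]

/-- A point of a closed ball is interior to every larger concentric ball, so a condition that
survives a slight enlargement selects a union of balls that is open. The maximal functions are
therefore lower semicontinuous, hence measurable, for arbitrary `u`. -/
theorem isOpen_setOf_exists_closedBall {P : (Fin n → ℝ) → ℝ → Prop}
    (hP : ∀ c r, 0 < r → P c r → ∃ r', r < r' ∧ P c r') :
    IsOpen {x | ∃ c r, 0 < r ∧ x ∈ closedBall c r ∧ P c r} := by
  rw [isOpen_iff_mem_nhds]
  rintro x ⟨c, r, hr, hx, h⟩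
  obtain ⟨r', hr', h'⟩ := hP c r hr h
  filter_upwards [ball_mem_nhds x (sub_pos.2 hr')] with y hy
  refine ⟨c, r', hr.trans hr', ?_, h'⟩
  have := dist_triangle y x c
  rw [mem_ball] at hy
  rw [mem_closedBall] at hx ⊢
  linarith

/-- The uncentred maximal function of a `[0, ∞]`-valued function over closed sup-norm balls. -/
noncomputable def ballMax (u : (Fin n → ℝ) → ℝ≥0∞) (x : Fin n → ℝ) : ℝ≥0∞ :=
  ⨆ (c : Fin n → ℝ) (r : ℝ) (_ : 0 < r) (_ : x ∈ closedBall c r),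
    (volume (closedBall c r))⁻¹ * ∫⁻ y in closedBall c r, u y

/-- The local maximal function of a `[0, ∞]`-valued function over closed sup-norm balls. -/
noncomputable def ballLocMax (t : ℝ≥0∞) (u : (Fin n → ℝ) → ℝ≥0∞) (x : Fin n → ℝ) : ℝ≥0∞ :=
  ⨆ (c : Fin n → ℝ) (r : ℝ) (_ : 0 < r) (_ : x ∈ closedBall c r),
    ⨅ (α : ℝ≥0∞) (_ : 0 < α) (_ : volume (closedBall c r ∩ {y | α < u y}) ≤
      t * volume (closedBall c r)), α

theorem average_le_ballMax (u : (Fin n → ℝ) → ℝ≥0∞) {x c : Fin n → ℝ} {r : ℝ} (hr : 0 < r)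
    (hx : x ∈ closedBall c r) :
    (volume (closedBall c r))⁻¹ * ∫⁻ y in closedBall c r, u y ≤ ballMax u x :=
  le_iSup_of_le c <| le_iSup_of_le r <| le_iSup_of_le hr <| le_iSup_of_le hx le_rfl

theorem lt_ballMax_iff {u : (Fin n → ℝ) → ℝ≥0∞} {x : Fin n → ℝ} {β : ℝ≥0∞} :
    β < ballMax u x ↔ ∃ c r, 0 < r ∧ x ∈ closedBall c r ∧
      β < (volume (closedBall c r))⁻¹ * ∫⁻ y in closedBall c r, u y := by
  simp only [ballMax, lt_iSup_iff, exists_prop]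

/-- This is right continuity of the distribution function: `{u > β}` is the increasing union of `{u
> b}` as `b` decreases to `β`. It turns the rearrangement into a density condition on superlevel
sets, the form used from here on. -/
theorem lt_iInf_level_iff {α : Type*} [MeasurableSpace α] {μ : Measure α} {s : Set α}
    {u : α → ℝ≥0∞} {T β : ℝ≥0∞} :
    β < (⨅ (a : ℝ≥0∞) (_ : 0 < a) (_ : μ (s ∩ {y | a < u y}) ≤ T), a) ↔
      T < μ (s ∩ {y | β < u y}) := by
  constructor
  · intro h
    by_contra! hT
    refine h.not_ge (le_of_forall_gt fun a ha => ?_)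
    obtain ⟨b, hb, hba⟩ := exists_between ha
    refine lt_of_le_of_lt (iInf_le_of_le b <| iInf_le_of_le (pos_of_gt hb) <|
      iInf_le_of_le ((measure_mono ?_).trans hT) le_rfl) hba
    exact Set.inter_subset_inter_right _ fun y hy => hb.trans hy
  · intro h
    have hβ : β < ∞ := by
      by_contra! hβ
      rw [top_le_iff] at hβ
      simp [hβ] at h
    obtain ⟨b, hb, hbm, hbt⟩ := exists_seq_strictAnti_tendsto' hβ
    have hU : s ∩ {y | β < u y} = ⋃ k, s ∩ {y | b k < u y} := by
      rw [← Set.inter_iUnion]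
      congr 1
      ext y
      simp only [Set.mem_ofPred_eq, Set.mem_iUnion]
      constructor
      · intro hy
        exact (hbt.eventually (gt_mem_nhds hy)).exists
      · rintro ⟨k, hk⟩
        exact (hbm k).1.trans hk
    rw [hU, Directed.measure_iUnion, lt_iSup_iff] at h
    · obtain ⟨k, hk⟩ := h
      refine (hbm k).1.trans_le (le_iInf fun a => le_iInf fun _ => le_iInf fun ha => ?_)
      by_contra! hlt
      refine hk.not_ge ((measure_mono ?_).trans ha)
      exact Set.inter_subset_inter_right _ fun y hy => hlt.trans hy
    · refine (monotone_nat_of_le_succ fun k => ?_).directed_le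
      exact Set.inter_subset_inter_right _ fun y hy => (hb (Nat.lt_succ_self k)).trans hy

theorem lt_ballLocMax_iff {t : ℝ≥0∞} {u : (Fin n → ℝ) → ℝ≥0∞} {x : Fin n → ℝ} {β : ℝ≥0∞} :
    β < ballLocMax t u x ↔ ∃ c r, 0 < r ∧ x ∈ closedBall c r ∧
      t * volume (closedBall c r) < volume (closedBall c r ∩ {y | β < u y}) := by
  simp only [ballLocMax, lt_iSup_iff, exists_prop, lt_iInf_level_iff]

theorem isOpen_lt_ballMax (u : (Fin n → ℝ) → ℝ≥0∞) (β : ℝ≥0∞) :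
    IsOpen {x | β < ballMax u x} := by
  simp only [lt_ballMax_iff]
  refine isOpen_setOf_exists_closedBall fun c r hr h => ?_
  have hlim : Tendsto (fun s => (volume (closedBall c s))⁻¹ * ∫⁻ y in closedBall c r, u y) (𝓝 r)
      (𝓝 ((volume (closedBall c r))⁻¹ * ∫⁻ y in closedBall c r, u y)) :=
    ENNReal.Tendsto.mul_const (tendsto_volume_closedBall c hr).inv
      (Or.inl (ENNReal.inv_ne_zero.2 (volume_closedBall_ne_top c r)))
  obtain ⟨s, hs, hrs⟩ := (((hlim.eventually (lt_mem_nhds h)).filter_mono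
    (nhdsWithin_le_nhds (s := Set.Ioi r))).and self_mem_nhdsWithin).exists
  refine ⟨s, hrs, hs.trans_le ?_⟩
  gcongr

theorem isOpen_lt_volume_inter (t : ℝ≥0∞) (E : Set (Fin n → ℝ)) :
    IsOpen {x | ∃ c r, 0 < r ∧ x ∈ closedBall c r ∧
      t * volume (closedBall c r) < volume (closedBall c r ∩ E)} := by
  refine isOpen_setOf_exists_closedBall fun c r hr h => ?_
  have hlim : Tendsto (fun s => t * volume (closedBall c s)) (𝓝 r)
      (𝓝 (t * volume (closedBall c r))) :=
    ENNReal.Tendsto.const_mul (tendsto_volume_closedBall c hr)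
      (Or.inl (volume_closedBall_pos c hr))
  obtain ⟨s, hs, hrs⟩ := (((hlim.eventually (gt_mem_nhds h)).filter_mono
    (nhdsWithin_le_nhds (s := Set.Ioi r))).and self_mem_nhdsWithin).exists
  refine ⟨s, hrs, hs.trans_le (measure_mono ?_)⟩
  exact Set.inter_subset_inter_left _ (closedBall_subset_closedBall (le_of_lt hrs))

theorem measurable_ballMax (u : (Fin n → ℝ) → ℝ≥0∞) : Measurable (ballMax u) :=
  (lowerSemicontinuous_iff_isOpen_preimage.2 fun β => isOpen_lt_ballMax u β).measurable

theorem measurable_ballLocMax (t : ℝ≥0∞) (u : (Fin n → ℝ) → ℝ≥0∞) :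
    Measurable (ballLocMax t u) := by
  refine (lowerSemicontinuous_iff_isOpen_preimage.2 fun β => ?_).measurable
  have h := isOpen_lt_volume_inter t {y | β < u y}
  simp only [← lt_ballLocMax_iff] at h
  exact h

theorem ballMax_mono_ae {u v : (Fin n → ℝ) → ℝ≥0∞} (h : u ≤ᵐ[volume] v) :
    ballMax u ≤ ballMax v := by
  intro x
  refine iSup_mono fun c => iSup_mono fun r => iSup_mono fun _ => iSup_mono fun _ => ?_
  gcongr 1
  exact lintegral_mono_ae (ae_restrict_of_ae h)

theorem ballMax_congr_ae {u v : (Fin n → ℝ) → ℝ≥0∞} (h : u =ᵐ[volume] v) :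
    ballMax u = ballMax v :=
  le_antisymm (ballMax_mono_ae h.le) (ballMax_mono_ae h.symm.le)

theorem ballMax_tsum_le {u : ℕ → (Fin n → ℝ) → ℝ≥0∞} (hu : ∀ k, Measurable (u k))
    (x : Fin n → ℝ) : ballMax (fun y => ∑' k, u k y) x ≤ ∑' k, ballMax (u k) x := by
  refine iSup_le fun c => iSup_le fun r => iSup_le fun hr => iSup_le fun hx => ?_
  rw [lintegral_tsum fun k => (hu k).aemeasurable, ← ENNReal.tsum_mul_left]
  exact ENNReal.tsum_le_tsum fun k => average_le_ballMax (u k) hr hx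

theorem ballMax_const_mul_le {u : (Fin n → ℝ) → ℝ≥0∞} (hu : Measurable u) (a : ℝ≥0∞)
    (x : Fin n → ℝ) : ballMax (fun y => a * u y) x ≤ a * ballMax u x := by
  refine iSup_le fun c => iSup_le fun r => iSup_le fun hr => iSup_le fun hx => ?_
  rw [lintegral_const_mul _ hu, mul_left_comm]
  gcongr
  exact average_le_ballMax u hr hx

theorem ballLocMax_congr_ae {t : ℝ≥0∞} {u v : (Fin n → ℝ) → ℝ≥0∞} (h : u =ᵐ[volume] v) :
    ballLocMax t u = ballLocMax t v := by
  have (s : Set (Fin n → ℝ)) (β : ℝ≥0∞) :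
      volume (s ∩ {y | β < u y}) = volume (s ∩ {y | β < v y}) := by
    refine measure_congr ?_
    filter_upwards [h] with y hy
    apply propext
    change (y ∈ s ∧ β < u y) ↔ (y ∈ s ∧ β < v y)
    rw [hy]
  unfold ballLocMax
  simp only [this]

theorem ballLocMax_anti {t t' : ℝ≥0∞} (h : t ≤ t') (u : (Fin n → ℝ) → ℝ≥0∞) :
    ballLocMax t' u ≤ ballLocMax t u := by
  refine fun x => le_of_forall_lt fun β hβ => ?_
  rw [lt_ballLocMax_iff] at hβ ⊢
  obtain ⟨c, r, hr, hx, hlt⟩ := hβ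
  exact ⟨c, r, hr, hx, (mul_le_mul_left h _).trans_lt hlt⟩

theorem ballLocMax_const_mul_le {t a : ℝ≥0∞} (ha : a ≠ 0) (ha' : a ≠ ∞)
    (u : (Fin n → ℝ) → ℝ≥0∞) (x : Fin n → ℝ) :
    ballLocMax t (fun y => a * u y) x ≤ a * ballLocMax t u x := by
  refine le_of_forall_lt fun β hβ => ?_
  rw [lt_ballLocMax_iff] at hβ
  obtain ⟨c, r, hr, hx, hlt⟩ := hβ
  have : β / a < ballLocMax t u x := by
    rw [lt_ballLocMax_iff]
    refine ⟨c, r, hr, hx, hlt.trans_le (measure_mono ?_)⟩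
    refine Set.inter_subset_inter_right _ fun y hy => ?_
    exact ENNReal.div_lt_of_lt_mul' hy
  rwa [ENNReal.div_lt_iff (Or.inl ha) (Or.inl ha'), mul_comm] at this

end Balls

/-! ### Passage from cubes to balls -/

section Cubes

open Metric

variable {n : ℕ}

theorem cube_eq_closedBall (a : Fin n → ℝ) {l : ℝ} (hl : 0 ≤ l) :
    cube a l = closedBall (fun i => a i + l / 2) (l / 2) := by
  ext x
  rw [mem_closedBall, dist_pi_le_iff (by positivity)]
  simp only [cube, Set.mem_Icc, Pi.le_def, Real.dist_eq, abs_le]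
  constructor
  · exact fun h i => ⟨by linarith [h.1 i], by linarith [h.2 i]⟩
  · exact fun h => ⟨fun i => by linarith [(h i).1], fun i => by linarith [(h i).2]⟩

theorem iSup_cube_eq_iSup_closedBall (F : Set (Fin n → ℝ) → ℝ≥0∞) (x : Fin n → ℝ) :
    (⨆ (a : Fin n → ℝ) (l : ℝ) (_ : 0 < l) (_ : x ∈ cube a l), F (cube a l)) =
      ⨆ (c : Fin n → ℝ) (r : ℝ) (_ : 0 < r) (_ : x ∈ closedBall c r), F (closedBall c r) := by
  apply le_antisymm
  · refine iSup_le fun a => iSup_le fun l => iSup_le fun hl => iSup_le fun hx => ?_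
    rw [cube_eq_closedBall a hl.le] at hx ⊢
    exact le_iSup_of_le _ <| le_iSup_of_le _ <| le_iSup_of_le (half_pos hl) <| le_iSup_of_le hx le_rfl
  · refine iSup_le fun c => iSup_le fun r => iSup_le fun hr => iSup_le fun hx => ?_
    have : closedBall c r = cube (fun i => c i - r) (2 * r) := by
      rw [cube_eq_closedBall _ (by positivity)]
      congr 1
      · ext i
        ring
      · ring
    rw [this] at hx ⊢
    exact le_iSup_of_le _ <| le_iSup_of_le _ <| le_iSup_of_le (by positivity) <|
      le_iSup_of_le hx le_rfl

theorem hlMaximal_eq_ballMax {𝕜 : Type*} [RCLike 𝕜] (f : (Fin n → ℝ) → 𝕜) :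
    hlMaximal f = ballMax fun y => ‖f y‖ₑ :=
  funext fun x => iSup_cube_eq_iSup_closedBall
    (fun Q => (volume Q)⁻¹ * ∫⁻ y in Q, ‖f y‖ₑ) x

theorem localMaximal_eq_ballLocMax {𝕜 : Type*} [RCLike 𝕜] (lam : ℝ) (f : (Fin n → ℝ) → 𝕜) :
    localMaximal lam f = ballLocMax (ENNReal.ofReal lam) fun y => ‖f y‖ₑ := by
  have h (Q : Set (Fin n → ℝ)) (α : ℝ≥0∞) :
      {x | α < ‖Q.indicator f x‖ₑ} = Q ∩ {y | α < ‖f y‖ₑ} := by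
    ext y
    by_cases hy : y ∈ Q <;> simp [hy]
  funext x
  refine Eq.trans ?_ (iSup_cube_eq_iSup_closedBall (fun Q => ⨅ (α : ℝ≥0∞) (_ : 0 < α)
    (_ : volume (Q ∩ {y | α < ‖f y‖ₑ}) ≤ ENNReal.ofReal lam * volume Q), α) x)
  simp only [localMaximal, rearrangement, h]

end Cubes

/-! ### Vitali covering and composition of local maximal operators -/

section Covering

open Metric

variable {n : ℕ}

theorem exists_countable_disjoint_closedBall {ι : Type*} (x : ι → Fin n → ℝ) (r : ι → ℝ) (R : ℝ)
    (hr : ∀ a, 0 < r a) (hR : ∀ a, r a ≤ R) :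
    ∃ s : Set ι, s.Countable ∧ (s.PairwiseDisjoint fun a => closedBall (x a) (r a)) ∧
      ∀ a, ∃ b ∈ s, closedBall (x a) (r a) ⊆ closedBall (x b) (5 * r b) := by
  obtain ⟨s, -, hd, hs⟩ := Vitali.exists_disjoint_subfamily_covering_enlargement_closedBall
    Set.univ x r R (fun a _ => hR a) 5 (by norm_num)
  refine ⟨s, hd.countable_of_nonempty_interior fun a _ => ?_, hd, fun a => hs a trivial⟩
  exact ⟨x a, ball_subset_interior_closedBall (mem_ball_self (hr a))⟩

/-- Let `B₀` be a ball witnessing the left side; each point of `B₀` where the inner function exceeds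
`β` has its own witness ball. If one of these is at least as large as `B₀`, its triple contains `x`
and already suffices. Otherwise all of them lie in `3B₀`, and a Vitali subfamily shows that `E`
fills more than `t² 5⁻ⁿ |B₀| = t² 15⁻ⁿ |3B₀|` of `3B₀`. -/
theorem ballLocMax_ballLocMax_le {t : ℝ≥0∞} (ht0 : t ≠ 0) (ht1 : t ≤ 1)
    (u : (Fin n → ℝ) → ℝ≥0∞) (x : Fin n → ℝ) :
    ballLocMax t (ballLocMax t u) x ≤ ballLocMax (t * t * (15 ^ n)⁻¹) u x := by
  have ht : t ≠ ∞ := (ht1.trans_lt ENNReal.one_lt_top).ne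
  refine le_of_forall_lt fun β hβ => ?_
  rw [lt_ballLocMax_iff] at hβ ⊢
  obtain ⟨c₀, r₀, hr₀, hx, hlt⟩ := hβ
  set E := {y | β < u y}
  have h15 : ((15 : ℝ≥0∞) ^ n)⁻¹ * 15 ^ n = 1 :=
    ENNReal.inv_mul_cancel (by simp) (by simp)
  have h35 : (15 : ℝ≥0∞) ^ n = 3 ^ n * 5 ^ n := by
    rw [← mul_pow]
    norm_num
  have hsel : ∀ y : ↥(closedBall c₀ r₀ ∩ {y | β < ballLocMax t u y}), ∃ c r, 0 < r ∧
      (y : Fin n → ℝ) ∈ closedBall c r ∧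
      t * volume (closedBall c r) < volume (closedBall c r ∩ E) :=
    fun y => lt_ballLocMax_iff.1 y.2.2
  choose c r hr hy hcr using hsel
  by_cases hbig : ∃ y, r₀ ≤ r y
  · obtain ⟨y, hry⟩ := hbig
    refine ⟨c y, 3 * r y, by linarith [hr y], ?_, ?_⟩
    · have h1 := hy y
      have h2 : dist (y : Fin n → ℝ) c₀ ≤ r₀ := y.2.1
      rw [mem_closedBall] at hx h1 ⊢
      have := dist_triangle4 x c₀ y (c y)
      rw [dist_comm c₀] at this
      linarith
    · refine lt_of_le_of_lt ?_ ((hcr y).trans_le (measure_mono (Set.inter_subset_inter_left _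
        (closedBall_subset_closedBall (by linarith [hr y])))))
      have h3 := volume_closedBall_ofNat_mul (c y) (c y) 3 (hr y).le
      push_cast at h3
      rw [h3]
      calc t * t * (15 ^ n)⁻¹ * (3 ^ n * volume (closedBall (c y) (r y)))
          ≤ t * 1 * (15 ^ n)⁻¹ * (15 ^ n * volume (closedBall (c y) (r y))) := by
            gcongr
            norm_num
        _ = t * (((15 : ℝ≥0∞) ^ n)⁻¹ * 15 ^ n) * volume (closedBall (c y) (r y)) := by ring
        _ = _ := by rw [h15, mul_one]
  · push Not at hbig
    obtain ⟨s, hsc, hsd, hs⟩ := exists_countable_disjoint_closedBall c r r₀ hr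
      fun y => (hbig y).le
    have : Countable s := hsc
    refine ⟨c₀, 3 * r₀, by linarith, closedBall_subset_closedBall (by linarith) hx, ?_⟩
    have hcover : volume (closedBall c₀ r₀ ∩ {y | β < ballLocMax t u y}) ≤
        5 ^ n * ∑' b : s, volume (closedBall (c b) (r b)) := by
      rw [← ENNReal.tsum_mul_left]
      refine (measure_mono (t := ⋃ b : s, closedBall (c b) (5 * r b)) fun y hyU => ?_).trans
        ((measure_iUnion_le _).trans (ENNReal.tsum_le_tsum fun b => ?_))
      · obtain ⟨b, hb, hsub⟩ := hs ⟨y, hyU⟩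
        exact Set.mem_iUnion.2 ⟨⟨b, hb⟩, hsub (hy ⟨y, hyU⟩)⟩
      · exact (volume_closedBall_ofNat_mul _ _ 5 (hr b).le).le
    have hsum : t * ∑' b : s, volume (closedBall (c b) (r b)) ≤
        volume (closedBall c₀ (3 * r₀) ∩ E) := by
      rw [← ENNReal.tsum_mul_left]
      calc ∑' b : s, t * volume (closedBall (c b) (r b))
          ≤ ∑' b : s, volume.restrict E (closedBall (c b) (r b)) := by
            refine ENNReal.tsum_le_tsum fun b => ?_
            rw [Measure.restrict_apply isClosed_closedBall.measurableSet]
            exact (hcr b).le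
        _ = volume.restrict E (⋃ b : s, closedBall (c b) (r b)) :=
            (measure_iUnion (f := fun b : s => closedBall (c b) (r b)) (fun a b hab => hsd a.2 b.2 (Subtype.coe_injective.ne hab))
              fun b => isClosed_closedBall.measurableSet).symm
        _ ≤ volume.restrict E (closedBall c₀ (3 * r₀)) := by
            refine measure_mono (Set.iUnion_subset fun b z hz => ?_)
            have h1 := hy b
            have h2 : dist (b.1.1 : Fin n → ℝ) c₀ ≤ r₀ := b.1.2.1
            have h3 := hbig b
            rw [mem_closedBall] at hz h1 ⊢
            have := dist_triangle4 z (c b) b.1.1 c₀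
            rw [dist_comm (c b)] at this
            linarith
        _ = _ := Measure.restrict_apply isClosed_closedBall.measurableSet
    refine lt_of_lt_of_le ?_ hsum
    have h3 := volume_closedBall_ofNat_mul c₀ c₀ 3 hr₀.le
    push_cast at h3
    have h5 : ((5 : ℝ≥0∞) ^ n)⁻¹ * 5 ^ n = 1 := ENNReal.inv_mul_cancel (by simp) (by simp)
    have h3' : ((3 : ℝ≥0∞) ^ n)⁻¹ * 3 ^ n = 1 := ENNReal.inv_mul_cancel (by simp) (by simp)
    calc t * t * (15 ^ n)⁻¹ * volume (closedBall c₀ (3 * r₀))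
        = t * (5 ^ n)⁻¹ * (t * volume (closedBall c₀ r₀)) := by
          rw [h3, h35, ENNReal.mul_inv (by simp) (by simp)]
          calc _ = t * (5 ^ n)⁻¹ * (t * volume (closedBall c₀ r₀)) *
                (((3 : ℝ≥0∞) ^ n)⁻¹ * 3 ^ n) := by ring
            _ = _ := by rw [h3', mul_one]
      _ < t * (5 ^ n)⁻¹ * volume (closedBall c₀ r₀ ∩ {y | β < ballLocMax t u y}) := by
          refine (ENNReal.mul_lt_mul_iff_right ?_ ?_).2 hlt
          · exact mul_ne_zero ht0 (by simp)
          · exact ENNReal.mul_ne_top ht (by simp)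
      _ ≤ t * (5 ^ n)⁻¹ * (5 ^ n * ∑' b : s, volume (closedBall (c b) (r b))) := by gcongr
      _ = t * (((5 : ℝ≥0∞) ^ n)⁻¹ * 5 ^ n) * ∑' b : s, volume (closedBall (c b) (r b)) := by ring
      _ = _ := by rw [h5, mul_one]

end Covering

/-! ### Gain of the local maximal operator against A₁ weights -/

section Weights

open Metric

variable {n : ℕ}

/-- Double the radius until the density of `E` first drops below `1/2`; this happens because `|E|`
is finite while the volumes grow without bound. The preceding radius still had density at least
`1/2`, so the stopping ball has density at least `2^-(n+1)`. -/
theorem exists_closedBall_density (hn : 1 ≤ n) {E : Set (Fin n → ℝ)} (hE : volume E ≠ ∞)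
    {x : Fin n → ℝ} {ρ : ℝ} (hρ : 0 < ρ)
    (hx : volume (closedBall x ρ) ≤ 2 * volume (closedBall x ρ ∩ E)) :
    ∃ r, 0 < r ∧ 2 * volume (closedBall x r ∩ E) < volume (closedBall x r) ∧
      volume (closedBall x r) ≤ 2 ^ (n + 1) * volume (closedBall x r ∩ E) := by
  let P : ℕ → Prop := fun m =>
    2 * volume (closedBall x (2 ^ m * ρ) ∩ E) < volume (closedBall x (2 ^ m * ρ))
  have hP : ∃ m, P m := by
    have h1 : Tendsto (fun m : ℕ => (2 * ((2 : ℝ) ^ m * ρ)) ^ n) atTop atTop :=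
      (tendsto_pow_atTop (by omega)).comp
        (((tendsto_pow_atTop_atTop_of_one_lt one_lt_two).atTop_mul_const hρ).const_mul_atTop
          two_pos)
    obtain ⟨m, hm⟩ := (h1.eventually (eventually_gt_atTop (2 * volume E).toReal)).exists
    refine ⟨m, ?_⟩
    change _ < _
    rw [Real.volume_pi_closedBall _ (by positivity), Fintype.card_fin]
    refine lt_of_le_of_lt (b := 2 * volume E) (by gcongr; exact Set.inter_subset_right) ?_
    rwa [ENNReal.lt_ofReal_iff_toReal_lt (ENNReal.mul_ne_top (by simp) hE)]
  classical
  let m := Nat.find hP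
  have hm : P m := Nat.find_spec hP
  have hm0 : m ≠ 0 := by
    intro h0
    rw [h0] at hm
    simp only [P, pow_zero, one_mul] at hm
    exact hm.not_ge hx
  obtain ⟨k, hk⟩ := Nat.exists_eq_succ_of_ne_zero hm0
  have hkP : ¬ P k := Nat.find_min hP (by change k < m; omega)
  rw [hk] at hm
  simp only [P, not_lt] at hkP hm
  refine ⟨_, by positivity, hm, ?_⟩
  have h2 := volume_closedBall_ofNat_mul x x 2 (r := 2 ^ k * ρ) (by positivity)
  have e : ((2 : ℕ) : ℝ) * (2 ^ k * ρ) = 2 ^ k.succ * ρ := by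
    rw [pow_succ]
    push_cast
    ring
  rw [e] at h2
  rw [h2, pow_succ, mul_assoc]
  push_cast
  gcongr
  refine hkP.trans ?_
  gcongr
  · norm_num
  · omega

theorem ae_exists_closedBall_density (hn : 1 ≤ n) {E : Set (Fin n → ℝ)} (hE : volume E ≠ ∞) :
    ∀ᵐ x ∂volume.restrict E, ∃ r, 0 < r ∧
      2 * volume (closedBall x r ∩ E) < volume (closedBall x r) ∧
      volume (closedBall x r) ≤ 2 ^ (n + 1) * volume (closedBall x r ∩ E) := by
  filter_upwards [Besicovitch.ae_tendsto_measure_inter_div (volume : Measure (Fin n → ℝ)) E]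
    with x hx
  have h := (hx.eventually (lt_mem_nhds (a := 2⁻¹) (by simp))).and self_mem_nhdsWithin
  obtain ⟨ρ, hρ, hρ0⟩ := h.exists
  refine exists_closedBall_density hn hE hρ0 ?_
  rw [ENNReal.lt_div_iff_mul_lt (Or.inl (volume_closedBall_pos x hρ0))
    (Or.inl (volume_closedBall_ne_top x ρ)), Set.inter_comm] at hρ
  calc volume (closedBall x ρ) = 2 * (2⁻¹ * volume (closedBall x ρ)) := by
        rw [← mul_assoc, ENNReal.mul_inv_cancel (by simp) (by simp), one_mul]
    _ ≤ _ := by gcongr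

/-- For an `A₁` weight, the weight of an enlarged ball is controlled by the weight of the part of
the ball outside a set of small density. -/
theorem withDensity_closedBall_le {G : (Fin n → ℝ) → ℝ≥0∞} (hG : Measurable G) {K : ℝ≥0∞}
    (hK : ∀ᵐ x, ballMax G x ≤ K * G x) {E : Set (Fin n → ℝ)} (hE : MeasurableSet E)
    {c : Fin n → ℝ} {r : ℝ} (hr : 0 < r)
    (hcr : 2 * volume (closedBall c r ∩ E) < volume (closedBall c r)) :
    volume.withDensity G (closedBall c (5 * r)) ≤
      K * 2 * 5 ^ n * volume.withDensity G (closedBall c r \ E) := by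
  have hm : MeasurableSet (closedBall c r \ E) := isClosed_closedBall.measurableSet.diff hE
  have hvol : volume (closedBall c r) ≤ 2 * volume (closedBall c r \ E) := by
    have h1 := measure_inter_add_sdiff (μ := volume) (closedBall c r) hE
    have h2 : volume (closedBall c r) + volume (closedBall c r) ≤
        volume (closedBall c r) + 2 * volume (closedBall c r \ E) := by
      calc _ = 2 * volume (closedBall c r ∩ E) + 2 * volume (closedBall c r \ E) := by
            rw [← two_mul, ← mul_add, h1]
        _ ≤ _ := by gcongr
    exact (ENNReal.add_le_add_iff_left (volume_closedBall_ne_top c r)).1 h2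
  set A := (volume (closedBall c (5 * r)))⁻¹ * ∫⁻ y in closedBall c (5 * r), G y with hA
  -- Every point of `B \ E` lies in `5B`, so the `A₁` condition bounds the average `A` over `5B` by
  -- `K * G` there.
  have hint : volume (closedBall c r \ E) * A ≤ K * ∫⁻ y in closedBall c r \ E, G y := by
    rw [← lintegral_const_mul _ hG, mul_comm, ← setLIntegral_const]
    refine lintegral_mono_ae ((ae_restrict_iff' hm).2 ?_)
    filter_upwards [hK] with y hy hyB
    refine le_trans (average_le_ballMax G (by positivity) ?_) hy
    exact closedBall_subset_closedBall (by linarith) hyB.1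
  have h5 := volume_closedBall_ofNat_mul c c 5 hr.le
  push_cast at h5
  rw [withDensity_apply _ isClosed_closedBall.measurableSet, withDensity_apply _ hm]
  calc ∫⁻ y in closedBall c (5 * r), G y = volume (closedBall c (5 * r)) * A := by
        rw [hA, ← mul_assoc, ENNReal.mul_inv_cancel (volume_closedBall_pos c (by positivity))
          (volume_closedBall_ne_top _ _), one_mul]
    _ ≤ 5 ^ n * (2 * volume (closedBall c r \ E)) * A := by
        rw [h5]
        gcongr
    _ = 2 * 5 ^ n * (volume (closedBall c r \ E) * A) := by ring
    _ ≤ 2 * 5 ^ n * (K * ∫⁻ y in closedBall c r \ E, G y) := by gcongr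
    _ = _ := by ring

/-- The stopping balls are dense enough in `E` to lie in the enlarged set, yet at least half of each
is outside `E`. Their fivefold Vitali enlargements cover almost all of `E`, while the disjoint
remainders `B \ E` carry a comparable share of the weight. The enlarged set thus gains a fixed
proportion of weight outside `E`. -/
theorem withDensity_le_withDensity_diff (hn : 1 ≤ n) {G : (Fin n → ℝ) → ℝ≥0∞}
    (hG : Measurable G) {K : ℝ≥0∞} (hK : ∀ᵐ x, ballMax G x ≤ K * G x) {t : ℝ≥0∞}
    (ht : t * 2 ^ (n + 1) < 1) {E : Set (Fin n → ℝ)} (hE : MeasurableSet E)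
    (hE' : volume E ≠ ∞) :
    volume.withDensity G E ≤ K * 2 * 5 ^ n * volume.withDensity G
      ({x | ∃ c r, 0 < r ∧ x ∈ closedBall c r ∧
        t * volume (closedBall c r) < volume (closedBall c r ∩ E)} \ E) := by
  set ν := volume.withDensity G
  set U := {x | ∃ c r, 0 < r ∧ x ∈ closedBall c r ∧
        t * volume (closedBall c r) < volume (closedBall c r ∩ E)}
  have hae := (ae_restrict_iff' hE).1 (ae_exists_closedBall_density hn hE')
  let A := {x | x ∈ E ∧ ∃ r, 0 < r ∧ 2 * volume (closedBall x r ∩ E) < volume (closedBall x r) ∧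
      volume (closedBall x r) ≤ 2 ^ (n + 1) * volume (closedBall x r ∩ E)}
  have hEA : ν E ≤ ν A := by
    refine measure_mono_ae ?_
    refine (withDensity_absolutelyContinuous volume G).ae_le ?_
    filter_upwards [hae] with x hx hxE using ⟨hxE, hx hxE⟩
  have hsel : ∀ x : A, ∃ r, 0 < r ∧
      2 * volume (closedBall (x : Fin n → ℝ) r ∩ E) < volume (closedBall (x : Fin n → ℝ) r) ∧
      volume (closedBall (x : Fin n → ℝ) r) ≤
        2 ^ (n + 1) * volume (closedBall (x : Fin n → ℝ) r ∩ E) := fun x => x.2.2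
  choose r hr hr1 hr2 using hsel
  -- Vitali needs bounded radii: the density bound gives `(2r)ⁿ ≤ 2^(n+1) |E|`, and `2r ≤ (2r)ⁿ`
  -- once `r > 1`.
  have hR : ∀ x : A, r x ≤ max 1 (2 ^ (n + 1) * volume E).toReal := by
    intro x
    by_contra! h
    rw [max_lt_iff] at h
    have h1 : volume (closedBall (x : Fin n → ℝ) (r x)) ≤ 2 ^ (n + 1) * volume E :=
      (hr2 x).trans (by gcongr; exact Set.inter_subset_right)
    rw [Real.volume_pi_closedBall _ (hr x).le, Fintype.card_fin,
      ENNReal.ofReal_le_iff_le_toReal (ENNReal.mul_ne_top (by simp) hE')] at h1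
    have h3 : 2 * r x ≤ (2 * r x) ^ n := le_self_pow₀ (by linarith) (by omega)
    linarith
  obtain ⟨s, hsc, hsd, hs⟩ := exists_countable_disjoint_closedBall
    (fun x : A => (x : Fin n → ℝ)) r _ hr hR
  have : Countable s := hsc
  calc ν E ≤ ν A := hEA
    _ ≤ ν (⋃ b : s, closedBall (b : A) (5 * r b)) := by
        refine measure_mono fun y hy => ?_
        obtain ⟨b, hb, hsub⟩ := hs ⟨y, hy⟩
        exact Set.mem_iUnion.2 ⟨⟨b, hb⟩, hsub (mem_closedBall_self (hr _).le)⟩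
    _ ≤ ∑' b : s, ν (closedBall (b : A) (5 * r b)) := measure_iUnion_le _
    _ ≤ ∑' b : s, K * 2 * 5 ^ n * ν (closedBall (b : A) (r b) \ E) :=
        ENNReal.tsum_le_tsum fun b => withDensity_closedBall_le hG hK hE (hr _) (hr1 _)
    _ = K * 2 * 5 ^ n * ν (⋃ b : s, closedBall (b : A) (r b) \ E) := by
        rw [ENNReal.tsum_mul_left, measure_iUnion]
        · intro a b hab
          exact (hsd a.2 b.2 (Subtype.coe_injective.ne hab)).mono Set.sdiff_subset Set.sdiff_subset
        · exact fun b => isClosed_closedBall.measurableSet.diff hE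
    _ ≤ K * 2 * 5 ^ n * ν (U \ E) := by
        gcongr
        refine Set.iUnion_subset fun b => Set.sdiff_subset_sdiff_left fun y hy => ?_
        refine ⟨_, r b, hr b, hy, ?_⟩
        have hpos : volume (closedBall ((b : A) : Fin n → ℝ) (r b) ∩ E) ≠ 0 := by
          intro h0
          have := hr2 b
          rw [h0, mul_zero, nonpos_iff_eq_zero] at this
          exact volume_closedBall_pos _ (hr b) this
        have hfin : volume (closedBall ((b : A) : Fin n → ℝ) (r b) ∩ E) ≠ ∞ :=
          measure_ne_top_of_subset Set.inter_subset_right hE'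
        calc t * volume (closedBall ((b : A) : Fin n → ℝ) (r b))
            ≤ t * (2 ^ (n + 1) * volume (closedBall ((b : A) : Fin n → ℝ) (r b) ∩ E)) := by
              gcongr
              exact hr2 b
          _ = t * 2 ^ (n + 1) * volume (closedBall ((b : A) : Fin n → ℝ) (r b) ∩ E) := by ring
          _ < 1 * volume (closedBall ((b : A) : Fin n → ℝ) (r b) ∩ E) :=
              (ENNReal.mul_lt_mul_iff_left hpos hfin).2 ht
          _ = _ := one_mul _

theorem withDensity_le_of_volume_ne_top (hn : 1 ≤ n) {G : (Fin n → ℝ) → ℝ≥0∞}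
    (hG : Measurable G) {K : ℝ≥0∞} (hK0 : K ≠ 0) (hK' : K ≠ ∞)
    (hK : ∀ᵐ x, ballMax G x ≤ K * G x) {t : ℝ≥0∞}
    (ht : t * 2 ^ (n + 1) < 1) {E : Set (Fin n → ℝ)} (hE : MeasurableSet E)
    (hE' : volume E ≠ ∞) :
    (1 + (K * 2 * 5 ^ n)⁻¹) * volume.withDensity G E ≤ volume.withDensity G
      {x | ∃ c r, 0 < r ∧ x ∈ closedBall c r ∧
        t * volume (closedBall c r) < volume (closedBall c r ∩ E)} := by
  have h := withDensity_le_withDensity_diff hn hG hK ht hE hE'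
  set ν := volume.withDensity G
  set U := {x | ∃ c r, 0 < r ∧ x ∈ closedBall c r ∧
        t * volume (closedBall c r) < volume (closedBall c r ∩ E)}
  have hEU : ν E ≤ ν (U ∩ E) := by
    refine measure_mono_ae ((withDensity_absolutelyContinuous volume G).ae_le ?_)
    have hae := (ae_restrict_iff' hE).1 (ae_exists_closedBall_density hn hE')
    filter_upwards [hae] with x hx hxE
    refine ⟨?_, hxE⟩
    obtain ⟨r, hr, -, hr2⟩ := hx hxE
    refine ⟨x, r, hr, mem_closedBall_self hr.le, ?_⟩
    have hpos : volume (closedBall x r ∩ E) ≠ 0 := by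
      intro h0
      rw [h0, mul_zero, nonpos_iff_eq_zero] at hr2
      exact volume_closedBall_pos _ hr hr2
    have hfin : volume (closedBall x r ∩ E) ≠ ∞ :=
      measure_ne_top_of_subset Set.inter_subset_right hE'
    calc t * volume (closedBall x r)
        ≤ t * (2 ^ (n + 1) * volume (closedBall x r ∩ E)) := by gcongr
      _ = t * 2 ^ (n + 1) * volume (closedBall x r ∩ E) := by ring
      _ < 1 * volume (closedBall x r ∩ E) := (ENNReal.mul_lt_mul_iff_left hpos hfin).2 ht
      _ = _ := one_mul _
  calc (1 + (K * 2 * 5 ^ n)⁻¹) * ν E = ν E + (K * 2 * 5 ^ n)⁻¹ * ν E := by ring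
    _ ≤ ν (U ∩ E) + (K * 2 * 5 ^ n)⁻¹ * (K * 2 * 5 ^ n * ν (U \ E)) := by gcongr
    _ = ν (U ∩ E) + ν (U \ E) := by
        rw [← mul_assoc, ENNReal.inv_mul_cancel, one_mul]
        · exact mul_ne_zero (mul_ne_zero hK0 (by simp)) (by simp)
        · exact ENNReal.mul_ne_top (ENNReal.mul_ne_top hK' (by simp)) (by simp)
    _ = ν U := measure_inter_add_sdiff _ hE

theorem withDensity_le_withDensity_density (hn : 1 ≤ n) {G : (Fin n → ℝ) → ℝ≥0∞}
    (hG : Measurable G) {K : ℝ≥0∞} (hK0 : K ≠ 0) (hK' : K ≠ ∞)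
    (hK : ∀ᵐ x, ballMax G x ≤ K * G x) {t : ℝ≥0∞}
    (ht : t * 2 ^ (n + 1) < 1) {E : Set (Fin n → ℝ)} (hE : MeasurableSet E) :
    (1 + (K * 2 * 5 ^ n)⁻¹) * volume.withDensity G E ≤ volume.withDensity G
      {x | ∃ c r, 0 < r ∧ x ∈ closedBall c r ∧
        t * volume (closedBall c r) < volume (closedBall c r ∩ E)} := by
  have hU : E = ⋃ k : ℕ, E ∩ closedBall 0 k := by
    rw [← Set.inter_iUnion, iUnion_closedBall_nat, Set.inter_univ]
  have hdir : Directed (fun x1 x2 => x1 ⊆ x2)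
      (fun k : ℕ => E ∩ closedBall (0 : Fin n → ℝ) k) := by
    refine (monotone_nat_of_le_succ fun k => ?_).directed_le
    exact Set.inter_subset_inter_right _ (closedBall_subset_closedBall (by push_cast; linarith))
  conv_lhs => rw [hU, hdir.measure_iUnion, ENNReal.mul_iSup]
  refine iSup_le fun k => ?_
  refine (withDensity_le_of_volume_ne_top hn hG hK0 hK' hK ht
    (hE.inter isClosed_closedBall.measurableSet)
    (measure_ne_top_of_subset Set.inter_subset_right (volume_closedBall_ne_top _ _))).trans ?_
  refine measure_mono ?_
  rintro x ⟨c, r, hr, hx, h⟩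
  exact ⟨c, r, hr, hx, h.trans_le (measure_mono (by
    exact Set.inter_subset_inter_right _ Set.inter_subset_left))⟩

theorem lintegral_eq_lintegral_ofReal_lt {α : Type*} [MeasurableSpace α] (μ : Measure α)
    [SFinite μ] {u : α → ℝ≥0∞} (hu : Measurable u) :
    ∫⁻ x, u x ∂μ = ∫⁻ s in Set.Ioi (0 : ℝ), μ {x | ENNReal.ofReal s < u x} := by
  have hpt (a : ℝ≥0∞) : a = ∫⁻ s in Set.Ioi (0 : ℝ),
      {s : ℝ | ENNReal.ofReal s < a}.indicator 1 s := by
    have hm : MeasurableSet {s : ℝ | ENNReal.ofReal s < a} :=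
      measurableSet_lt ENNReal.measurable_ofReal measurable_const
    rw [lintegral_indicator_one hm, Measure.restrict_apply hm]
    induction a with
    | top => simp
    | coe a =>
      have : {s : ℝ | ENNReal.ofReal s < a} ∩ Set.Ioi 0 = Set.Ioo 0 (a : ℝ) := by
        ext s
        simp only [Set.mem_inter_iff, Set.mem_ofPred_eq, Set.mem_Ioi, Set.mem_Ioo]
        rw [and_comm]
        refine and_congr_right fun hs => ?_
        rw [← ENNReal.ofReal_coe_nnreal, ENNReal.ofReal_lt_ofReal_iff_of_nonneg hs.le]
      rw [this, Real.volume_Ioo, sub_zero, ENNReal.ofReal_coe_nnreal]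
  calc ∫⁻ x, u x ∂μ = ∫⁻ x, (∫⁻ s in Set.Ioi (0 : ℝ),
        {s : ℝ | ENNReal.ofReal s < u x}.indicator 1 s) ∂μ :=
        lintegral_congr fun x => hpt (u x)
    _ = ∫⁻ s in Set.Ioi (0 : ℝ), ∫⁻ x, {s : ℝ | ENNReal.ofReal s < u x}.indicator 1 s ∂μ := by
        refine lintegral_lintegral_swap ?_
        have hm : MeasurableSet {p : α × ℝ | ENNReal.ofReal p.2 < u p.1} :=
          measurableSet_lt (ENNReal.measurable_ofReal.comp measurable_snd)
            (hu.comp measurable_fst)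
        exact ((measurable_one (α := ℝ≥0∞)).indicator hm).aemeasurable
    _ = _ := by
        refine lintegral_congr fun s => ?_
        rw [← lintegral_indicator_one (measurableSet_lt measurable_const hu)]
        rfl

/-- By the layer cake formula it suffices to compare superlevel sets, and `{m_t u > s}` is exactly
the enlargement of `{u > s}` treated above. -/
theorem lintegral_mul_le_lintegral_ballLocMax_mul (hn : 1 ≤ n) {G : (Fin n → ℝ) → ℝ≥0∞}
    (hG : Measurable G) {K : ℝ≥0∞} (hK0 : K ≠ 0) (hK' : K ≠ ∞)
    (hK : ∀ᵐ x, ballMax G x ≤ K * G x) {t : ℝ≥0∞}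
    (ht : t * 2 ^ (n + 1) < 1) {u : (Fin n → ℝ) → ℝ≥0∞} (hu : Measurable u) :
    (1 + (K * 2 * 5 ^ n)⁻¹) * ∫⁻ x, u x * G x ≤ ∫⁻ x, ballLocMax t u x * G x := by
  have e (v : (Fin n → ℝ) → ℝ≥0∞) (hv : Measurable v) :
      ∫⁻ x, v x * G x = ∫⁻ x, v x ∂volume.withDensity G := by
    rw [lintegral_withDensity_eq_lintegral_mul _ hG hv]
    simp only [Pi.mul_apply, mul_comm]
  rw [e u hu, e _ (measurable_ballLocMax t u), lintegral_eq_lintegral_ofReal_lt _ hu,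
    lintegral_eq_lintegral_ofReal_lt _ (measurable_ballLocMax t u), ← lintegral_const_mul']
  · refine lintegral_mono fun s => ?_
    simp only [lt_ballLocMax_iff]
    exact withDensity_le_withDensity_density hn hG hK0 hK' hK ht
      (measurableSet_lt measurable_const hu)
  · simp [hK0]

end Weights

/-! ### Linearizing the maximal operator and bounding its adjoint -/

section Linearization

open Metric

variable {n : ℕ}

/-- The intersection contains a whole ball of radius `r₀`: move from a common point `z` towards `c`
by the fraction `r₀ / r` to find its centre. -/
theorem volume_closedBall_le_inter {c c₀ : Fin n → ℝ} {r r₀ : ℝ} (hr₀ : 0 < r₀) (hr : r₀ ≤ r)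
    (h : (closedBall c r ∩ closedBall c₀ r₀).Nonempty) :
    volume (closedBall c₀ r₀) ≤ volume (closedBall c r ∩ closedBall c₀ (3 * r₀)) := by
  obtain ⟨z, hz, hz₀⟩ := h
  have hr' : 0 < r := hr₀.trans_le hr
  rw [mem_closedBall] at hz hz₀
  set θ := r₀ / r with hθ
  have hθ0 : 0 ≤ θ := by positivity
  have hθ1 : θ ≤ 1 := (div_le_one hr').2 hr
  have hθr : θ * r = r₀ := div_mul_cancel₀ _ hr'.ne'
  set w := z + θ • (c - z) with hw
  have hwz : dist w z ≤ r₀ := by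
    rw [dist_eq_norm, hw, add_sub_cancel_left, norm_smul, Real.norm_of_nonneg hθ0,
      ← dist_eq_norm, dist_comm, ← hθr]
    gcongr
  have hwc : dist w c ≤ r - r₀ := by
    have e : w - c = (1 - θ) • (z - c) := by
      rw [hw]
      module
    rw [dist_eq_norm, e, norm_smul, Real.norm_of_nonneg (by linarith), ← dist_eq_norm]
    calc (1 - θ) * dist z c ≤ (1 - θ) * r := by
          gcongr
      _ = _ := by rw [sub_mul, one_mul, hθr]
  have hv := volume_closedBall_ofNat_mul w c₀ 1 hr₀.le
  simp only [Nat.cast_one, one_mul, one_pow] at hv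
  rw [← hv]
  refine measure_mono fun y hy => ?_
  rw [mem_closedBall] at hy
  constructor
  · rw [mem_closedBall]
    linarith [dist_triangle y w c]
  · rw [mem_closedBall]
    linarith [dist_triangle4 y w z c₀]

/-- The adjoint of the linearized maximal operator attached to balls `closedBall (c k) (r k)` and
sets `E k`. -/
noncomputable def ballSum {ι : Type*} (s : Finset ι) (c : ι → Fin n → ℝ) (r : ι → ℝ)
    (E : ι → Set (Fin n → ℝ)) (f : (Fin n → ℝ) → ℝ≥0∞) (x : Fin n → ℝ) : ℝ≥0∞ :=
  ∑ k ∈ s, (volume (closedBall (c k) (r k)))⁻¹ * (∫⁻ y in E k, f y) *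
    (closedBall (c k) (r k)).indicator 1 x

theorem lintegral_mul_ballSum {ι : Type*} (s : Finset ι) (c : ι → Fin n → ℝ) (r : ι → ℝ)
    (E : ι → Set (Fin n → ℝ)) (f : (Fin n → ℝ) → ℝ≥0∞) {g : (Fin n → ℝ) → ℝ≥0∞}
    (hg : Measurable g) :
    ∫⁻ x, ballSum s c r E f x * g x = ∑ k ∈ s, (volume (closedBall (c k) (r k)))⁻¹ *
      (∫⁻ y in closedBall (c k) (r k), g y) * ∫⁻ y in E k, f y := by
  have (k : ι) (x : Fin n → ℝ) : (closedBall (c k) (r k)).indicator 1 x * g x =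
      (closedBall (c k) (r k)).indicator g x := by
    by_cases hx : x ∈ closedBall (c k) (r k)
    · simp only [Set.indicator_of_mem hx, Pi.one_apply, one_mul]
    · simp only [Set.indicator_of_notMem hx, zero_mul]
  have hm (k : ι) : Measurable ((closedBall (c k) (r k)).indicator g) :=
    hg.indicator isClosed_closedBall.measurableSet
  simp only [ballSum, Finset.sum_mul, mul_assoc, this]
  rw [lintegral_finsetSum _ fun k _ => ((hm k).const_mul _).const_mul _]
  refine Finset.sum_congr rfl fun k _ => ?_
  rw [lintegral_const_mul _ ((hm k).const_mul _), lintegral_const_mul _ (hm k),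
    lintegral_indicator isClosed_closedBall.measurableSet]
  ring

theorem sum_setLIntegral_le {ι : Type*} (s : Finset ι) {E : ι → Set (Fin n → ℝ)}
    (hE : ∀ k ∈ s, MeasurableSet (E k)) (hd : (s : Set ι).PairwiseDisjoint E)
    {A : Set (Fin n → ℝ)} (hA : ∀ k ∈ s, E k ⊆ A) (f : (Fin n → ℝ) → ℝ≥0∞) :
    ∑ k ∈ s, ∫⁻ y in E k, f y ≤ ∫⁻ y in A, f y := by
  rw [← lintegral_biUnion_finset hd hE]
  exact lintegral_mono_set (Set.iUnion₂_subset hA)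

/-- On a witness ball `B₀`, split the sum by comparing `r k` with `r₀`. The large balls contribute
at most the constant `A`; each fills at least `|B₀|` of `3B₀`, so `A` is controlled by an average of
the sum itself. The small balls lie in `3B₀`, and since the `E k` are disjoint their total integral
is at most `∫ f` over `3B₀`; Chebyshev's inequality then costs the factor `t⁻¹`. -/
theorem ballLocMax_ballSum_le {ι : Type*} (s : Finset ι) (c : ι → Fin n → ℝ) (r : ι → ℝ)
    (hr : ∀ k, 0 < r k) {E : ι → Set (Fin n → ℝ)} (hE : ∀ k, MeasurableSet (E k))
    (hd : Pairwise fun i j => Disjoint (E i) (E j)) (hEB : ∀ k, E k ⊆ closedBall (c k) (r k))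
    (f : (Fin n → ℝ) → ℝ≥0∞) {t : ℝ≥0∞} (ht : t ≠ 0) (ht' : t ≠ ∞) (x : Fin n → ℝ) :
    ballLocMax t (ballSum s c r E f) x ≤
      3 ^ n * ballMax (ballSum s c r E f) x + t⁻¹ * 3 ^ n * ballMax f x := by
  classical
  refine le_of_forall_lt_imp_le_of_dense fun β hβ => ?_
  obtain ⟨c₀, r₀, hr₀, hx, hlt⟩ := lt_ballLocMax_iff.1 hβ
  let B : ι → Set (Fin n → ℝ) := fun k => closedBall (c k) (r k)
  let B₀ := closedBall c₀ r₀
  let a : ι → ℝ≥0∞ := fun k => (volume (B k))⁻¹ * (∫⁻ y in E k, f y)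
  let T := ballSum s c r E f
  let Lg := s.filter fun k => r₀ ≤ r k ∧ (B k ∩ B₀).Nonempty
  let Sm := s.filter fun k => r k < r₀ ∧ (B k ∩ B₀).Nonempty
  let S : (Fin n → ℝ) → ℝ≥0∞ := fun y => ∑ k ∈ Sm, a k * (B k).indicator 1 y
  let A := ∑ k ∈ Lg, a k
  have hBm (k : ι) : MeasurableSet (B k) := isClosed_closedBall.measurableSet
  have hx3 : x ∈ closedBall c₀ (3 * r₀) := closedBall_subset_closedBall (by linarith) hx
  have h3 := volume_closedBall_ofNat_mul c₀ c₀ 3 hr₀.le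
  push_cast at h3
  have h33 : (3 : ℝ≥0∞) ^ n * ((3 : ℝ≥0∞) ^ n)⁻¹ = 1 := ENNReal.mul_inv_cancel (by simp) (by simp)
  have hv0 : volume B₀ ≠ 0 := volume_closedBall_pos c₀ hr₀
  have hv1 : volume B₀ ≠ ∞ := volume_closedBall_ne_top c₀ r₀
  have hTS : ∀ y ∈ B₀, T y ≤ A + S y := by
    intro y hy
    have hle : ∀ k ∈ s, a k * (B k).indicator 1 y ≤
        (if r₀ ≤ r k ∧ (B k ∩ B₀).Nonempty then a k else 0) +
          (if r k < r₀ ∧ (B k ∩ B₀).Nonempty then a k * (B k).indicator 1 y else 0) := by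
      intro k _
      by_cases hyk : y ∈ B k
      · have hne : (B k ∩ B₀).Nonempty := ⟨y, hyk, hy⟩
        rcases le_or_gt r₀ (r k) with h | h
        · simp [h, hne, hyk]
        · simp [h, hne, hyk]
      · simp [hyk]
    calc T y ≤ _ := Finset.sum_le_sum hle
      _ = A + S y := by
        rw [Finset.sum_add_distrib, ← Finset.sum_filter, ← Finset.sum_filter]
  have hA : A ≤ 3 ^ n * ballMax T x := by
    have h1 : A * volume B₀ ≤ ∫⁻ y in closedBall c₀ (3 * r₀), T y := by
      calc A * volume B₀ = ∑ k ∈ Lg, a k * volume B₀ := Finset.sum_mul _ _ _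
        _ ≤ ∑ k ∈ s, a k * volume (B k ∩ closedBall c₀ (3 * r₀)) := by
            refine (Finset.sum_le_sum fun k hk => ?_).trans
              (Finset.sum_le_sum_of_subset (Finset.filter_subset _ s))
            have hk' := (Finset.mem_filter.1 hk).2
            exact mul_le_mul_right (volume_closedBall_le_inter hr₀ hk'.1 hk'.2) _
        _ = ∫⁻ y in closedBall c₀ (3 * r₀), T y := by
            change _ = ∫⁻ y in closedBall c₀ (3 * r₀), ∑ k ∈ s, a k * (B k).indicator 1 y
            rw [lintegral_finsetSum _ fun k _ => (measurable_one.indicator (hBm k)).const_mul _]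
            refine Finset.sum_congr rfl fun k _ => ?_
            rw [lintegral_const_mul _ (measurable_one.indicator (hBm k)),
              lintegral_indicator_one (hBm k), Measure.restrict_apply (hBm k)]
    have h2 := average_le_ballMax T (by positivity) hx3
    calc A = (volume B₀)⁻¹ * volume B₀ * A := by
          rw [ENNReal.inv_mul_cancel hv0 hv1, one_mul]
      _ = (3 ^ n * ((3 : ℝ≥0∞) ^ n)⁻¹) * ((volume B₀)⁻¹ * (A * volume B₀)) := by
          rw [h33]
          ring
      _ ≤ (3 ^ n * ((3 : ℝ≥0∞) ^ n)⁻¹) *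
          ((volume B₀)⁻¹ * ∫⁻ y in closedBall c₀ (3 * r₀), T y) := by gcongr
      _ = 3 ^ n * ((volume (closedBall c₀ (3 * r₀)))⁻¹ *
          ∫⁻ y in closedBall c₀ (3 * r₀), T y) := by
          rw [h3, ENNReal.mul_inv (by simp) (by simp)]
          ring
      _ ≤ _ := by gcongr
  have hS : ∫⁻ y in B₀, S y ≤ volume B₀ * (3 ^ n * ballMax f x) := by
    calc ∫⁻ y in B₀, S y ≤ ∫⁻ y, S y := setLIntegral_le_lintegral _ _
      _ = ∑ k ∈ Sm, a k * volume (B k) := by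
          rw [lintegral_finsetSum _ fun k _ => (measurable_one.indicator (hBm k)).const_mul _]
          refine Finset.sum_congr rfl fun k _ => ?_
          rw [lintegral_const_mul _ (measurable_one.indicator (hBm k)),
            lintegral_indicator_one (hBm k)]
      _ = ∑ k ∈ Sm, ∫⁻ y in E k, f y := by
          refine Finset.sum_congr rfl fun k _ => ?_
          rw [mul_right_comm, ENNReal.inv_mul_cancel (volume_closedBall_pos _ (hr k))
            (volume_closedBall_ne_top _ _), one_mul]
      _ ≤ ∫⁻ y in closedBall c₀ (3 * r₀), f y := by
          refine sum_setLIntegral_le _ (fun k _ => hE k) (fun i _ j _ hij => hd hij)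
            (fun k hk => ?_) f
          obtain ⟨-, hk1, z, hzk, hz0⟩ := Finset.mem_filter.1 hk
          refine (hEB k).trans fun y hy => ?_
          have hz0' : dist z c₀ ≤ r₀ := hz0
          have hzk' : dist z (c k) ≤ r k := hzk
          rw [mem_closedBall] at hy ⊢
          have := dist_triangle4 y (c k) z c₀
          rw [dist_comm (c k)] at this
          linarith
      _ = volume (closedBall c₀ (3 * r₀)) * ((volume (closedBall c₀ (3 * r₀)))⁻¹ *
            ∫⁻ y in closedBall c₀ (3 * r₀), f y) := by
          rw [← mul_assoc, ENNReal.mul_inv_cancel (volume_closedBall_pos _ (by positivity))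
            (volume_closedBall_ne_top _ _), one_mul]
      _ ≤ volume (closedBall c₀ (3 * r₀)) * ballMax f x := by
          gcongr
          exact average_le_ballMax f (by positivity) hx3
      _ = _ := by
          rw [h3]
          ring
  rcases le_or_gt β A with hβA | hβA
  · exact hβA.trans (hA.trans le_self_add)
  · have hsub : B₀ ∩ {y | β < T y} ⊆ {y | β - A ≤ S y} ∩ B₀ := by
      rintro y ⟨hy, hyβ⟩
      refine ⟨?_, hy⟩
      exact tsub_le_iff_left.2 ((le_of_lt hyβ).trans (hTS y hy))
    have hSm : Measurable S :=
      Finset.measurable_sum _ fun k _ => (measurable_one.indicator (hBm k)).const_mul _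
    have hcheb : (β - A) * (t * volume B₀) ≤ volume B₀ * (3 ^ n * ballMax f x) := by
      refine le_trans ?_ ((mul_meas_ge_le_lintegral hSm (β - A)).trans hS)
      gcongr
      refine (hlt.le.trans (measure_mono hsub)).trans ?_
      rw [Measure.restrict_apply (measurableSet_le measurable_const hSm)]
    have hγ : β - A ≤ t⁻¹ * 3 ^ n * ballMax f x := by
      calc β - A = (t⁻¹ * t) * ((volume B₀)⁻¹ * volume B₀) * (β - A) := by
            rw [ENNReal.inv_mul_cancel hv0 hv1, ENNReal.inv_mul_cancel ht ht', one_mul, one_mul]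
        _ = t⁻¹ * (volume B₀)⁻¹ * ((β - A) * (t * volume B₀)) := by ring
        _ ≤ t⁻¹ * (volume B₀)⁻¹ * (volume B₀ * (3 ^ n * ballMax f x)) := by gcongr
        _ = ((volume B₀)⁻¹ * volume B₀) * (t⁻¹ * 3 ^ n * ballMax f x) := by ring
        _ = _ := by rw [ENNReal.inv_mul_cancel hv0 hv1, one_mul]
    calc β ≤ A + (β - A) := le_add_tsub
      _ ≤ _ := add_le_add hA hγ

/-- A countable family is needed for monotone convergence. A ball of radius `r` lies in one with
centre in a dense sequence at distance less than `r` and rational radius between `2r` and `3r`; the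
volume grows by at most `3ⁿ`. -/
theorem exists_countable_balls (n : ℕ) :
    ∃ (c : ℕ → Fin n → ℝ) (r : ℕ → ℝ), (∀ k, 0 < r k) ∧
      ∀ (u : (Fin n → ℝ) → ℝ≥0∞) (x : Fin n → ℝ), ballMax u x ≤
        3 ^ n * ⨆ k, (volume (closedBall (c k) (r k)))⁻¹ *
          (∫⁻ y in closedBall (c k) (r k), u y) * (closedBall (c k) (r k)).indicator 1 x := by
  obtain ⟨φ, hφ⟩ := exists_surjective_nat (ℕ × {q : ℚ // 0 < q})
  refine ⟨fun k => TopologicalSpace.denseSeq _ (φ k).1, fun k => ((φ k).2 : ℚ),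
    fun k => Rat.cast_pos.2 (φ k).2.2, fun u x => ?_⟩
  refine iSup_le fun c => iSup_le fun r => iSup_le fun hr => iSup_le fun hx => ?_
  obtain ⟨q, hq1, hq2⟩ := exists_rat_btwn (show 2 * r < 3 * r by linarith)
  have hq0 : 0 < q := by
    have : (0 : ℝ) < q := by linarith
    exact_mod_cast this
  obtain ⟨i, hi⟩ := (TopologicalSpace.denseRange_denseSeq (Fin n → ℝ)).exists_dist_lt c hr
  obtain ⟨k, hk⟩ := hφ (i, ⟨q, hq0⟩)
  have hsub : closedBall c r ⊆
      closedBall (TopologicalSpace.denseSeq (Fin n → ℝ) (φ k).1) ((φ k).2 : ℚ) := by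
    rw [hk]
    intro y hy
    rw [mem_closedBall] at hy ⊢
    have := dist_triangle y c (TopologicalSpace.denseSeq (Fin n → ℝ) i)
    linarith
  refine le_trans ?_ (mul_le_mul_right (le_iSup _ k) _)
  rw [Set.indicator_of_mem (hsub hx), Pi.one_apply, mul_one, ← mul_assoc]
  have hvol : volume (closedBall (TopologicalSpace.denseSeq (Fin n → ℝ) (φ k).1) ((φ k).2 : ℚ)) ≤
      3 ^ n * volume (closedBall c r) := by
    have h3 := volume_closedBall_ofNat_mul (TopologicalSpace.denseSeq (Fin n → ℝ) (φ k).1) c 3 hr.le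
    push_cast at h3
    rw [← h3]
    refine measure_mono (closedBall_subset_closedBall ?_)
    rw [hk]
    exact hq2.le
  gcongr
  calc (volume (closedBall c r))⁻¹
      = 3 ^ n * (3 ^ n * volume (closedBall c r))⁻¹ := by
        rw [ENNReal.mul_inv (by simp) (by simp), ← mul_assoc,
          ENNReal.mul_inv_cancel (by simp) (by simp), one_mul]
    _ ≤ _ := by gcongr

/-- Assign each point to the first index whose set contains it and whose coefficient equals the
supremum. -/
theorem exists_disjoint_sup_le {α : Type*} [MeasurableSpace α] {B : ℕ → Set α}
    (hB : ∀ k, MeasurableSet (B k)) (a : ℕ → ℝ≥0∞) (m : ℕ) :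
    ∃ E : ℕ → Set α, (∀ k, MeasurableSet (E k)) ∧ (Pairwise fun i j => Disjoint (E i) (E j)) ∧
      (∀ k, E k ⊆ B k) ∧ ∀ x, ((Finset.range m).sup fun k => a k * (B k).indicator 1 x) ≤
        ∑ k ∈ Finset.range m, a k * (E k).indicator 1 x := by
  let σ : α → ℝ≥0∞ := fun x => (Finset.range m).sup fun k => a k * (B k).indicator 1 x
  have hσ : Measurable σ := by
    simp only [σ, Finset.sup_eq_iSup]
    exact Measurable.iSup fun k => Measurable.iSup fun _ =>
      (measurable_one.indicator (hB k)).const_mul _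
  let A : ℕ → Set α := fun k => B k ∩ {x | σ x = a k}
  have hA (k : ℕ) : MeasurableSet (A k) :=
    (hB k).inter (hσ (measurableSet_singleton _))
  refine ⟨disjointed A, fun k => MeasurableSet.disjointed hA k, disjoint_disjointed A,
    fun k => (disjointed_subset A k).trans Set.inter_subset_left, fun x => ?_⟩
  change σ x ≤ _
  rcases eq_or_ne (σ x) 0 with h0 | h0
  · rw [h0]
    exact zero_le
  · have hne : (Finset.range m).Nonempty := by
      by_contra! he
      simp [σ, he] at h0
    obtain ⟨k, hk, hkσ⟩ := Finset.exists_mem_eq_sup _ hne fun k => a k * (B k).indicator 1 x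
    have hσk : σ x = a k * (B k).indicator 1 x := hkσ
    have hxB : x ∈ B k := by
      by_contra hx
      rw [Set.indicator_of_notMem hx, mul_zero] at hσk
      exact h0 hσk
    rw [Set.indicator_of_mem hxB, Pi.one_apply, mul_one] at hσk
    have hxA : x ∈ A k := ⟨hxB, hσk⟩
    have hxU : x ∈ partialSups A k := (le_partialSups A k) hxA
    rw [← partialSups_disjointed, partialSups_eq_biUnion_range] at hxU
    simp only [Set.mem_iUnion, Finset.mem_range, exists_prop] at hxU
    obtain ⟨j, hj, hxj⟩ := hxU
    have hjm : j ∈ Finset.range m := by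
      rw [Finset.mem_range] at hk ⊢
      omega
    have hσj : σ x = a j := (disjointed_subset A j hxj).2
    rw [hσj]
    calc a j = a j * (disjointed A j).indicator 1 x := by
          rw [Set.indicator_of_mem hxj, Pi.one_apply, mul_one]
      _ ≤ _ := Finset.single_le_sum (f := fun k => a k * (disjointed A k).indicator 1 x)
          (fun _ _ => zero_le) hjm

end Linearization

/-! ### Representing extended nonnegative functions in L⁰ -/

section Representatives

variable {n : ℕ}

theorem exists_lzero_eq_toReal (𝕜 : Type*) [RCLike 𝕜] {u : (Fin n → ℝ) → ℝ≥0∞}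
    (hu : AEMeasurable u) : ∃ g : LZero n 𝕜, ∀ᵐ x, g x = ((u x).toReal : 𝕜) := by
  have hm : AEStronglyMeasurable (fun x => (((u x).toReal : ℝ) : 𝕜)) volume :=
    (RCLike.measurable_ofReal.comp_aemeasurable hu.ennreal_toReal).aestronglyMeasurable
  exact ⟨AEEqFun.mk _ hm, AEEqFun.coeFn_mk _ hm⟩

theorem enorm_ofReal_toReal {𝕜 : Type*} [RCLike 𝕜] {a : ℝ≥0∞} (ha : a ≠ ∞) :
    ‖((a.toReal : ℝ) : 𝕜)‖ₑ = a := by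
  rw [← ofReal_norm, RCLike.norm_ofReal, abs_of_nonneg ENNReal.toReal_nonneg,
    ENNReal.ofReal_toReal ha]

theorem exists_lzero_enorm_eq (𝕜 : Type*) [RCLike 𝕜] {u : (Fin n → ℝ) → ℝ≥0∞}
    (hu : AEMeasurable u) (hfin : ∀ᵐ x, u x ≠ ∞) :
    ∃ g : LZero n 𝕜, ∀ᵐ x, u x = ‖g x‖ₑ := by
  obtain ⟨g, hg⟩ := exists_lzero_eq_toReal 𝕜 hu
  refine ⟨g, ?_⟩
  filter_upwards [hg, hfin] with x hx hx'
  rw [hx, enorm_ofReal_toReal hx']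

end Representatives

/-! ### Calculus of the extended norm and the associate norm -/

namespace FunctionSpace

open Metric

variable {n : ℕ} {𝕜 : Type*} [RCLike 𝕜] {X : FunctionSpace n 𝕜}

theorem IsBanachFunctionSpace.norm_le (hX : X.IsBanachFunctionSpace) {f g : X.carrier}
    (h : ∀ᵐ x, ‖(g : LZero n 𝕜) x‖ₑ ≤ ‖(f : LZero n 𝕜) x‖ₑ) : X.norm g ≤ X.norm f :=
  (hX.ideal f g (h.mono fun _ hx => enorm_le_iff_norm_le.1 hx)).2

theorem IsBanachFunctionSpace.extNorm_eq (hX : X.IsBanachFunctionSpace)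
    {u : (Fin n → ℝ) → ℝ≥0∞} {h : X.carrier} (hu : ∀ᵐ x, u x = ‖(h : LZero n 𝕜) x‖ₑ) :
    X.extNorm u = ENNReal.ofReal (X.norm h) := by
  apply le_antisymm
  · exact iInf₂_le h hu
  · refine le_iInf₂ fun g hg => ENNReal.ofReal_le_ofReal (hX.norm_le ?_)
    filter_upwards [hu, hg] with x hx hx'
    rw [← hx, hx']

theorem exists_enorm_eq_of_extNorm_ne_top {u : (Fin n → ℝ) → ℝ≥0∞} (hu : X.extNorm u ≠ ∞) :
    ∃ h : X.carrier, ∀ᵐ x, u x = ‖(h : LZero n 𝕜) x‖ₑ := by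
  by_contra hne
  refine hu ?_
  simp only [extNorm, iInf_eq_top]
  exact fun h hh => absurd ⟨h, hh⟩ hne

theorem aemeasurable_of_extNorm_ne_top {u : (Fin n → ℝ) → ℝ≥0∞} (hu : X.extNorm u ≠ ∞) :
    AEMeasurable u := by
  obtain ⟨h, hh⟩ := exists_enorm_eq_of_extNorm_ne_top hu
  exact ((h : LZero n 𝕜).aestronglyMeasurable.enorm).congr (hh.mono fun _ hx => hx.symm)

theorem ae_ne_top_of_extNorm_ne_top {u : (Fin n → ℝ) → ℝ≥0∞} (hu : X.extNorm u ≠ ∞) :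
    ∀ᵐ x, u x ≠ ∞ := by
  obtain ⟨h, hh⟩ := exists_enorm_eq_of_extNorm_ne_top hu
  filter_upwards [hh] with x hx
  rw [hx]
  exact enorm_ne_top

theorem extNorm_congr {u v : (Fin n → ℝ) → ℝ≥0∞} (h : u =ᵐ[volume] v) :
    X.extNorm u = X.extNorm v := by
  unfold extNorm
  refine iInf_congr fun g => iInf_congr_Prop ?_ fun _ => rfl
  constructor
  · intro hu
    filter_upwards [h, hu] with x h1 h2
    rw [← h1, h2]
  · intro hu
    filter_upwards [h, hu] with x h1 h2
    rw [h1, h2]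

theorem IsBanachFunctionSpace.exists_carrier (hX : X.IsBanachFunctionSpace)
    {u : (Fin n → ℝ) → ℝ≥0∞} (hu : X.extNorm u ≠ ∞) :
    ∃ h : X.carrier, (∀ᵐ x, (h : LZero n 𝕜) x = ((u x).toReal : 𝕜)) ∧
      X.extNorm u = ENNReal.ofReal (X.norm h) := by
  obtain ⟨h, hh⟩ := exists_enorm_eq_of_extNorm_ne_top hu
  obtain ⟨g, hg⟩ := exists_lzero_eq_toReal 𝕜 (aemeasurable_of_extNorm_ne_top hu)
  have hug : ∀ᵐ x, u x = ‖g x‖ₑ := by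
    filter_upwards [hg, ae_ne_top_of_extNorm_ne_top hu] with x hx hx'
    rw [hx, enorm_ofReal_toReal hx']
  obtain ⟨hgX, -⟩ := hX.ideal h g (by
    filter_upwards [hh, hug] with x h1 h2
    rw [← enorm_le_iff_norm_le, ← h1, h2])
  exact ⟨⟨g, hgX⟩, hg, hX.extNorm_eq hug⟩

theorem IsBanachFunctionSpace.extNorm_mono (hX : X.IsBanachFunctionSpace)
    {u v : (Fin n → ℝ) → ℝ≥0∞} (hu : AEMeasurable u) (huv : u ≤ᵐ[volume] v) :
    X.extNorm u ≤ X.extNorm v := by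
  by_cases hv : X.extNorm v = ∞
  · rw [hv]
    exact le_top
  obtain ⟨h, hh⟩ := exists_enorm_eq_of_extNorm_ne_top hv
  obtain ⟨g, hg⟩ := exists_lzero_enorm_eq 𝕜 hu (by
    filter_upwards [huv, ae_ne_top_of_extNorm_ne_top hv] with x h1 h2
    exact ne_top_of_le_ne_top h2 h1)
  have hle : ∀ᵐ x, ‖g x‖ ≤ ‖(h : LZero n 𝕜) x‖ := by
    filter_upwards [huv, hh, hg] with x h1 h2 h3
    rwa [← enorm_le_iff_norm_le, ← h2, ← h3]
  obtain ⟨hgX, hn⟩ := hX.ideal h g hle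
  rw [hX.extNorm_eq hh, hX.extNorm_eq (h := ⟨g, hgX⟩) hg]
  exact ENNReal.ofReal_le_ofReal hn

theorem IsBanachFunctionSpace.extNorm_zero (hX : X.IsBanachFunctionSpace) :
    X.extNorm (fun _ => 0) = 0 := by
  rw [hX.extNorm_eq (h := 0)]
  · simp
  · filter_upwards [AEEqFun.coeFn_zero (μ := (volume : Measure (Fin n → ℝ))) (β := 𝕜)] with x hx
    simp [hx]

theorem IsBanachFunctionSpace.extNorm_add_le (hX : X.IsBanachFunctionSpace)
    (u v : (Fin n → ℝ) → ℝ≥0∞) :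
    X.extNorm (fun x => u x + v x) ≤ X.extNorm u + X.extNorm v := by
  by_cases hu : X.extNorm u = ∞
  · simp [hu]
  by_cases hv : X.extNorm v = ∞
  · simp [hv]
  obtain ⟨f, hf, hfn⟩ := hX.exists_carrier hu
  obtain ⟨g, hg, hgn⟩ := hX.exists_carrier hv
  rw [hX.extNorm_eq (h := f + g), hfn, hgn,
    ← ENNReal.ofReal_add (apply_nonneg _ _) (apply_nonneg _ _)]
  · exact ENNReal.ofReal_le_ofReal (map_add_le_add _ _ _)
  · filter_upwards [hf, hg, AEEqFun.coeFn_add (f : LZero n 𝕜) g, ae_ne_top_of_extNorm_ne_top hu,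
      ae_ne_top_of_extNorm_ne_top hv] with x h1 h2 h3 h4 h5
    rw [Submodule.coe_add, h3, Pi.add_apply, h1, h2, ← RCLike.ofReal_add,
      ← ENNReal.toReal_add h4 h5, enorm_ofReal_toReal (ENNReal.add_ne_top.2 ⟨h4, h5⟩)]

theorem IsBanachFunctionSpace.extNorm_const_mul_le (hX : X.IsBanachFunctionSpace) {a : ℝ≥0∞}
    (ha : a ≠ ∞) {u : (Fin n → ℝ) → ℝ≥0∞} (hu : X.extNorm u ≠ ∞) :
    X.extNorm (fun x => a * u x) ≤ a * X.extNorm u := by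
  obtain ⟨f, hf⟩ := exists_enorm_eq_of_extNorm_ne_top hu
  rw [hX.extNorm_eq (h := ((a.toReal : ℝ) : 𝕜) • f), hX.extNorm_eq hf, map_smul_eq_mul,
    ENNReal.ofReal_mul (norm_nonneg _), ofReal_norm, enorm_ofReal_toReal ha]
  filter_upwards [hf, AEEqFun.coeFn_smul ((a.toReal : ℝ) : 𝕜) (f : LZero n 𝕜)] with x h1 h2
  rw [Submodule.coe_smul, h2, Pi.smul_apply, smul_eq_mul, enorm_mul, enorm_ofReal_toReal ha, h1]

theorem IsBanachFunctionSpace.extNorm_sum_ne_top (hX : X.IsBanachFunctionSpace) {ι : Type*}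
    (s : Finset ι) {u : ι → (Fin n → ℝ) → ℝ≥0∞} (hu : ∀ k ∈ s, X.extNorm (u k) ≠ ∞) :
    X.extNorm (fun x => ∑ k ∈ s, u k x) ≠ ∞ := by
  classical
  induction s using Finset.induction_on with
  | empty =>
    simp only [Finset.sum_empty, hX.extNorm_zero]
    exact ENNReal.zero_ne_top
  | insert i s hi ih =>
    simp only [Finset.sum_insert hi]
    refine ne_top_of_le_ne_top (ENNReal.add_ne_top.2 ⟨hu i (Finset.mem_insert_self i s), ih
      fun k hk => hu k (Finset.mem_insert_of_mem hk)⟩) (hX.extNorm_add_le _ _)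

/-- The Fatou property transferred to `[0, ∞]`-valued functions by choosing nonnegative
representatives. -/
theorem IsBanachFunctionSpace.extNorm_iSup_le (hX : X.IsBanachFunctionSpace)
    {v : ℕ → (Fin n → ℝ) → ℝ≥0∞} (hv : Monotone v) (hfin : ∀ᵐ x, ⨆ j, v j x ≠ ∞)
    {a : ℝ≥0∞} (ha : a ≠ ∞) (hva : ∀ j, X.extNorm (v j) ≤ a) :
    X.extNorm (fun x => ⨆ j, v j x) ≤ a := by
  have hvt (j : ℕ) : X.extNorm (v j) ≠ ∞ := ne_top_of_le_ne_top ha (hva j)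
  choose f hf hfn using fun j => hX.exists_carrier (hvt j)
  obtain ⟨F, hF⟩ := exists_lzero_eq_toReal 𝕜
    (AEMeasurable.iSup fun j => aemeasurable_of_extNorm_ne_top (hvt j))
  have hle (j : ℕ) : X.norm (f j) ≤ a.toReal := by
    rw [← ENNReal.ofReal_le_iff_le_toReal ha, ← hfn]
    exact hva j
  obtain ⟨hFX, hFn⟩ := hX.fatou f F (by
    filter_upwards [ae_all_iff.2 hf, hF, hfin] with x h1 h2 h3
    have hj (j : ℕ) : v j x ≠ ∞ := ne_top_of_le_ne_top h3 (le_iSup (fun j => v j x) j)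
    refine ⟨fun j => ?_, fun i j hij => ?_, ?_⟩
    · rw [h1]
      exact RCLike.ofReal_nonneg.2 ENNReal.toReal_nonneg
    · simp only [h1]
      exact RCLike.ofReal_le_ofReal.2 (ENNReal.toReal_mono (hj j) (hv hij x))
    · simp only [h1, h2]
      refine (RCLike.continuous_ofReal.tendsto _).comp ((ENNReal.tendsto_toReal h3).comp ?_)
      exact tendsto_atTop_iSup fun i j hij => hv hij x)
    ⟨a.toReal, by
      rintro _ ⟨j, rfl⟩
      exact hle j⟩
  rw [hX.extNorm_eq (h := ⟨F, hFX⟩), hFn, ENNReal.ofReal_le_iff_le_toReal ha]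
  · exact ciSup_le hle
  · filter_upwards [hF, hfin] with x h1 h2
    rw [h1, enorm_ofReal_toReal h2]

/-- The norm of a `[0, ∞]`-valued function in the associate space. -/
noncomputable def dualNorm (X : FunctionSpace n 𝕜) (g : (Fin n → ℝ) → ℝ≥0∞) : ℝ≥0∞ :=
  ⨆ (h : X.carrier) (_ : X.norm h ≤ 1), ∫⁻ x, ‖(h : LZero n 𝕜) x‖ₑ * g x

theorem assocENorm_eq_dualNorm {f : LZero n 𝕜} {g : (Fin n → ℝ) → ℝ≥0∞}
    (h : ∀ᵐ x, g x = ‖f x‖ₑ) : X.assocENorm f = X.dualNorm g := by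
  unfold assocENorm dualNorm
  refine iSup_congr fun k => iSup_congr fun _ => lintegral_congr_ae ?_
  filter_upwards [h] with x hx
  rw [enorm_mul, hx, mul_comm]

theorem IsBanachFunctionSpace.lintegral_mul_le (hX : X.IsBanachFunctionSpace)
    {u : (Fin n → ℝ) → ℝ≥0∞} (hu : X.extNorm u ≠ ∞) (g : (Fin n → ℝ) → ℝ≥0∞) :
    ∫⁻ x, u x * g x ≤ X.extNorm u * X.dualNorm g := by
  obtain ⟨h, hh⟩ := exists_enorm_eq_of_extNorm_ne_top hu
  rw [hX.extNorm_eq hh]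
  -- The null case is separate: the right side may read `0 * ∞ = 0`, and definiteness of the norm
  -- makes the left side vanish too.
  rcases (apply_nonneg X.norm h).eq_or_lt with h0 | h0
  · have hz := hX.eq_zero_of_norm_eq_zero h h0.symm
    rw [← h0, ENNReal.ofReal_zero, zero_mul, nonpos_iff_eq_zero]
    have : ∀ᵐ x, u x * g x = 0 := by
      filter_upwards [hh, AEEqFun.coeFn_zero (μ := (volume : Measure (Fin n → ℝ))) (β := 𝕜)]
        with x h1 h2
      rw [h1, hz, Submodule.coe_zero, h2]
      simp
    rw [lintegral_congr_ae this]
    simp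
  · set s := X.norm h
    have hs0 : ENNReal.ofReal s ≠ 0 := (ENNReal.ofReal_pos.2 h0).ne'
    let k : X.carrier := ((s⁻¹ : ℝ) : 𝕜) • h
    have hk : X.norm k ≤ 1 := by
      rw [map_smul_eq_mul, RCLike.norm_ofReal, abs_of_pos (inv_pos.2 h0),
        inv_mul_cancel₀ h0.ne']
    calc ∫⁻ x, u x * g x = ∫⁻ x, ENNReal.ofReal s * (‖(k : LZero n 𝕜) x‖ₑ * g x) := by
          refine lintegral_congr_ae ?_
          filter_upwards [hh, AEEqFun.coeFn_smul ((s⁻¹ : ℝ) : 𝕜) (h : LZero n 𝕜)] with x h1 h2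
          rw [Submodule.coe_smul, h2, Pi.smul_apply, smul_eq_mul, enorm_mul, ← h1, ← ofReal_norm,
            RCLike.norm_ofReal, abs_of_pos (inv_pos.2 h0), ENNReal.ofReal_inv_of_pos h0,
            ← mul_assoc, ← mul_assoc, ENNReal.mul_inv_cancel hs0 ENNReal.ofReal_ne_top, one_mul]
      _ = ENNReal.ofReal s * ∫⁻ x, ‖(k : LZero n 𝕜) x‖ₑ * g x :=
          lintegral_const_mul' _ _ ENNReal.ofReal_ne_top
      _ ≤ _ := by
          gcongr
          exact le_iSup₂ (f := fun (h : X.carrier) (_ : X.norm h ≤ 1) =>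
            ∫⁻ x, ‖(h : LZero n 𝕜) x‖ₑ * g x) k hk

theorem IsBanachFunctionSpace.exists_extNorm_ballMax_le (hX : X.IsBanachFunctionSpace)
    (hM : X.MaximalBounded) :
    ∃ C : ℝ≥0∞, 1 ≤ C ∧ C ≠ ∞ ∧ ∀ u, X.extNorm (ballMax u) ≤ C * X.extNorm u := by
  obtain ⟨C, hC⟩ := hM
  -- Adding `1` keeps the constant nonzero, so the bound also holds when `X.extNorm u = ∞`.
  refine ⟨C + 1, le_add_self, by simp, fun u => ?_⟩
  by_cases hu : X.extNorm u = ∞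
  · rw [hu, ENNReal.mul_top (by simp)]
    exact le_top
  refine le_trans ?_ (mul_le_mul_left (le_add_right le_rfl) _)
  obtain ⟨h, hh⟩ := exists_enorm_eq_of_extNorm_ne_top hu
  rw [hX.extNorm_eq hh, ballMax_congr_ae hh, ← hlMaximal_eq_ballMax]
  exact hC h

/-- Homogeneity extends the bound from the unit sphere to all of `X`. -/
theorem IsBanachFunctionSpace.mul_extNorm_le_of_lt_phi (hX : X.IsBanachFunctionSpace) {κ : ℝ≥0∞}
    {lam : ℝ} (hκ : κ ≤ X.phi lam) {u : (Fin n → ℝ) → ℝ≥0∞} (hu : X.extNorm u ≠ ∞) :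
    κ * X.extNorm u ≤ X.extNorm (ballLocMax (ENNReal.ofReal lam) u) := by
  by_cases hm : X.extNorm (ballLocMax (ENNReal.ofReal lam) u) = ∞
  · rw [hm]
    exact le_top
  obtain ⟨h, hh⟩ := exists_enorm_eq_of_extNorm_ne_top hu
  rw [hX.extNorm_eq hh]
  rcases (apply_nonneg X.norm h).eq_or_lt with h0 | h0
  · simp [← h0]
  set s := X.norm h
  have hs0 : ENNReal.ofReal s ≠ 0 := (ENNReal.ofReal_pos.2 h0).ne'
  have hs1 : ENNReal.ofReal s ≠ ∞ := ENNReal.ofReal_ne_top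
  let k : X.carrier := ((s⁻¹ : ℝ) : 𝕜) • h
  have hk : X.norm k = 1 := by
    rw [map_smul_eq_mul, RCLike.norm_ofReal, abs_of_pos (inv_pos.2 h0), inv_mul_cancel₀ h0.ne']
  have hku : ∀ᵐ x, ‖(k : LZero n 𝕜) x‖ₑ = (ENNReal.ofReal s)⁻¹ * u x := by
    filter_upwards [hh, AEEqFun.coeFn_smul ((s⁻¹ : ℝ) : 𝕜) (h : LZero n 𝕜)] with x h1 h2
    rw [Submodule.coe_smul, h2, Pi.smul_apply, smul_eq_mul, enorm_mul, ← h1, ← ofReal_norm,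
      RCLike.norm_ofReal, abs_of_pos (inv_pos.2 h0), ENNReal.ofReal_inv_of_pos h0]
  have h1 : κ ≤ (ENNReal.ofReal s)⁻¹ * X.extNorm (ballLocMax (ENNReal.ofReal lam) u) := by
    calc κ ≤ X.extNorm (localMaximal lam (k : LZero n 𝕜)) := hκ.trans (iInf₂_le k hk)
      _ = X.extNorm (ballLocMax (ENNReal.ofReal lam) fun x => (ENNReal.ofReal s)⁻¹ * u x) := by
          rw [localMaximal_eq_ballLocMax, ballLocMax_congr_ae hku]
      _ ≤ X.extNorm (fun x => (ENNReal.ofReal s)⁻¹ * ballLocMax (ENNReal.ofReal lam) u x) :=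
          hX.extNorm_mono (measurable_ballLocMax _ _).aemeasurable <| .of_forall fun x =>
            ballLocMax_const_mul_le (ENNReal.inv_ne_zero.2 hs1) (ENNReal.inv_ne_top.2 hs0) u x
      _ ≤ _ := hX.extNorm_const_mul_le (ENNReal.inv_ne_top.2 hs0) hm
  calc κ * ENNReal.ofReal s ≤ (ENNReal.ofReal s)⁻¹ *
        X.extNorm (ballLocMax (ENNReal.ofReal lam) u) * ENNReal.ofReal s := by gcongr
    _ = (ENNReal.ofReal s)⁻¹ * ENNReal.ofReal s *
        X.extNorm (ballLocMax (ENNReal.ofReal lam) u) := by ring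
    _ = _ := by rw [ENNReal.inv_mul_cancel hs0 hs1, one_mul]

theorem IsBanachFunctionSpace.le_phi (hX : X.IsBanachFunctionSpace) {κ : ℝ≥0∞} {lam : ℝ}
    (h : ∀ u, Measurable u → X.extNorm u = 1 →
      κ ≤ X.extNorm (ballLocMax (ENNReal.ofReal lam) u)) : κ ≤ X.phi lam := by
  refine le_iInf₂ fun f hf => ?_
  rw [localMaximal_eq_ballLocMax]
  refine h _ (f : LZero n 𝕜).stronglyMeasurable.enorm ?_
  rw [hX.extNorm_eq (h := f) (.of_forall fun _ => rfl), hf, ENNReal.ofReal_one]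

theorem IsBanachFunctionSpace.extNorm_ballMax_ne_top (hX : X.IsBanachFunctionSpace)
    (hM : X.MaximalBounded) {u : (Fin n → ℝ) → ℝ≥0∞} (hu : X.extNorm u ≠ ∞) :
    X.extNorm (ballMax u) ≠ ∞ := by
  obtain ⟨C, -, hC, h⟩ := hX.exists_extNorm_ballMax_le hM
  exact ne_top_of_le_ne_top (ENNReal.mul_ne_top hC hu) (h u)

/-- Saturation provides one `χ_F` in `X` with `|F| > 0`, and `M χ_F` is bounded below by a positive
constant on any given ball. -/
theorem IsBanachFunctionSpace.extNorm_indicator_closedBall_ne_top (hX : X.IsBanachFunctionSpace)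
    (hM : X.MaximalBounded) (c : Fin n → ℝ) {r : ℝ} (hr : 0 < r) :
    X.extNorm ((closedBall c r).indicator 1) ≠ ∞ := by
  obtain ⟨F, -, hFm, hF, h, hhX, hh⟩ := hX.saturation Set.univ MeasurableSet.univ
    (isOpen_univ.measure_pos _ Set.univ_nonempty)
  have hFN : X.extNorm (F.indicator 1) ≠ ∞ := by
    rw [hX.extNorm_eq (h := ⟨h, hhX⟩)]
    · exact ENNReal.ofReal_ne_top
    · filter_upwards [hh] with x hx
      rw [hx]
      by_cases hxF : x ∈ F <;> simp [hxF]
  obtain ⟨k, hk⟩ : ∃ k : ℕ, volume (F ∩ closedBall c k) ≠ 0 := by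
    by_contra! h0
    refine hF.ne' ?_
    have := measure_iUnion_null h0
    rwa [← Set.inter_iUnion, iUnion_closedBall_nat, Set.inter_univ] at this
  set R := max (k : ℝ) r
  have hR : 0 < R := lt_max_of_lt_right hr
  set d := (volume (closedBall c R))⁻¹ * volume (F ∩ closedBall c R) with hd
  have hd0 : d ≠ 0 := by
    refine mul_ne_zero (ENNReal.inv_ne_zero.2 (volume_closedBall_ne_top _ _)) fun h0 => hk ?_
    refine measure_mono_null (Set.inter_subset_inter_right _ ?_) h0
    exact closedBall_subset_closedBall (le_max_left _ _)
  have hd1 : d ≠ ∞ :=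
    ENNReal.mul_ne_top (ENNReal.inv_ne_top.2 (volume_closedBall_pos _ hR))
      (measure_ne_top_of_subset Set.inter_subset_right (volume_closedBall_ne_top _ _))
  have hle : ∀ x, (closedBall c r).indicator 1 x ≤ d⁻¹ * ballMax (F.indicator 1) x := by
    intro x
    by_cases hx : x ∈ closedBall c r
    · rw [Set.indicator_of_mem hx, Pi.one_apply, ← ENNReal.inv_mul_cancel hd0 hd1]
      gcongr
      refine le_trans (le_of_eq ?_) (average_le_ballMax _ hR
        (closedBall_subset_closedBall (le_max_right _ _) hx))
      rw [lintegral_indicator_one hFm, Measure.restrict_apply hFm]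
    · rw [Set.indicator_of_notMem hx]
      exact zero_le
  refine ne_top_of_le_ne_top ?_ (hX.extNorm_mono
    (measurable_one.indicator isClosed_closedBall.measurableSet).aemeasurable (.of_forall hle))
  have hN := hX.extNorm_ballMax_ne_top hM hFN
  exact ne_top_of_le_ne_top (ENNReal.mul_ne_top (ENNReal.inv_ne_top.2 hd0) hN)
    (hX.extNorm_const_mul_le (ENNReal.inv_ne_top.2 hd0) hN)

/-- An infinite integral over a ball would make `Mu = ∞` on that whole ball. -/
theorem IsBanachFunctionSpace.setLIntegral_closedBall_ne_top (hX : X.IsBanachFunctionSpace)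
    (hM : X.MaximalBounded) {u : (Fin n → ℝ) → ℝ≥0∞} (hu : X.extNorm u ≠ ∞) (c : Fin n → ℝ)
    {r : ℝ} (hr : 0 < r) : ∫⁻ x in closedBall c r, u x ≠ ∞ := by
  intro htop
  have h1 := ae_ne_top_of_extNorm_ne_top (hX.extNorm_ballMax_ne_top hM hu)
  refine volume_closedBall_pos c hr (measure_mono_null (fun x hx => ?_) (ae_iff.1 h1))
  have := average_le_ballMax u hr hx
  rw [htop, ENNReal.mul_top (ENNReal.inv_ne_zero.2 (volume_closedBall_ne_top _ _)),
    top_le_iff] at this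
  simpa using this

theorem IsBanachFunctionSpace.ae_ne_top_of_dualNorm_ne_top (hX : X.IsBanachFunctionSpace)
    (hM : X.MaximalBounded) {g : (Fin n → ℝ) → ℝ≥0∞} (hg : Measurable g)
    (hD : X.dualNorm g ≠ ∞) : ∀ᵐ x, g x ≠ ∞ := by
  have hball (k : ℕ) : ∀ᵐ x ∂volume.restrict (closedBall (0 : Fin n → ℝ) (k + 1)), g x ≠ ∞ := by
    have hN := hX.extNorm_indicator_closedBall_ne_top hM 0 (r := (k : ℝ) + 1) (by positivity)
    have hint : ∫⁻ x in closedBall (0 : Fin n → ℝ) (k + 1), g x ≠ ∞ := by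
      refine ne_top_of_le_ne_top (ENNReal.mul_ne_top hN hD)
        (le_trans (le_of_eq ?_) (hX.lintegral_mul_le hN g))
      rw [← lintegral_indicator isClosed_closedBall.measurableSet]
      refine lintegral_congr fun x => ?_
      by_cases hx : x ∈ closedBall (0 : Fin n → ℝ) (k + 1)
      · simp only [Set.indicator_of_mem hx, Pi.one_apply, one_mul]
      · simp only [Set.indicator_of_notMem hx, zero_mul]
    filter_upwards [ae_lt_top hg hint] with x hx using hx.ne
  have hU : ⋃ k : ℕ, closedBall (0 : Fin n → ℝ) (k + 1) = Set.univ := by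
    refine Set.eq_univ_of_subset (Set.iUnion_mono fun k => ?_)
      (iUnion_closedBall_nat (0 : Fin n → ℝ))
    exact closedBall_subset_closedBall (by linarith)
  have := (ae_restrict_iUnion_iff _ _).2 hball
  rwa [hU, Measure.restrict_univ] at this

end FunctionSpace

/-! ### Duality and absorption; self-improvement of φ_X -/

namespace FunctionSpace

open Metric

variable {n : ℕ} {𝕜 : Type*} [RCLike 𝕜] {X : FunctionSpace n 𝕜}

theorem IsBanachFunctionSpace.extNorm_ballSum_ne_top (hX : X.IsBanachFunctionSpace)
    (hM : X.MaximalBounded) {ι : Type*} (s : Finset ι) (c : ι → Fin n → ℝ) (r : ι → ℝ)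
    (hr : ∀ k, 0 < r k) {E : ι → Set (Fin n → ℝ)} (hEB : ∀ k, E k ⊆ closedBall (c k) (r k))
    {f : (Fin n → ℝ) → ℝ≥0∞} (hf : X.extNorm f ≠ ∞) :
    X.extNorm (ballSum s c r E f) ≠ ∞ := by
  refine hX.extNorm_sum_ne_top s fun k _ => ?_
  have hN := hX.extNorm_indicator_closedBall_ne_top hM (c k) (hr k)
  have ha : (volume (closedBall (c k) (r k)))⁻¹ * ∫⁻ y in E k, f y ≠ ∞ := by
    refine ENNReal.mul_ne_top (ENNReal.inv_ne_top.2 (volume_closedBall_pos _ (hr k))) ?_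
    exact ne_top_of_le_ne_top (hX.setLIntegral_closedBall_ne_top hM hf (c k) (hr k))
      (lintegral_mono_set (hEB k))
  exact ne_top_of_le_ne_top (ENNReal.mul_ne_top ha hN) (hX.extNorm_const_mul_le ha hN)

/-- The factor `2` in the hypothesis leaves one copy of `3 ^ n * C * X.extNorm T` after the other is
absorbed. The bound is independent of the family, which is what the passage to the full maximal
operator requires. -/
theorem IsBanachFunctionSpace.extNorm_ballSum_le (hX : X.IsBanachFunctionSpace)
    (hM : X.MaximalBounded) {C : ℝ≥0∞} (hC1 : 1 ≤ C) (hC : C ≠ ∞)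
    (hMC : ∀ u, X.extNorm (ballMax u) ≤ C * X.extNorm u) {t : ℝ≥0∞} (ht : t ≠ 0) (ht' : t ≠ ∞)
    (hφ : ∀ u, X.extNorm u ≠ ∞ → 2 * (3 ^ n * C) * X.extNorm u ≤ X.extNorm (ballLocMax t u))
    {ι : Type*} (s : Finset ι) (c : ι → Fin n → ℝ) (r : ι → ℝ)
    (hr : ∀ k, 0 < r k) {E : ι → Set (Fin n → ℝ)} (hE : ∀ k, MeasurableSet (E k))
    (hd : Pairwise fun i j => Disjoint (E i) (E j)) (hEB : ∀ k, E k ⊆ closedBall (c k) (r k))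
    {f : (Fin n → ℝ) → ℝ≥0∞} (hf : X.extNorm f ≠ ∞) :
    X.extNorm (ballSum s c r E f) ≤ t⁻¹ * 3 ^ n * C * X.extNorm f := by
  set T := ballSum s c r E f
  have hT : X.extNorm T ≠ ∞ := hX.extNorm_ballSum_ne_top hM s c r hr hEB hf
  have h3 : (3 : ℝ≥0∞) ^ n ≠ ∞ := by simp
  have ht3 : t⁻¹ * 3 ^ n ≠ ∞ := ENNReal.mul_ne_top (ENNReal.inv_ne_top.2 ht) h3
  have hmain : 3 ^ n * C * X.extNorm T + 3 ^ n * C * X.extNorm T ≤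
      3 ^ n * C * X.extNorm T + t⁻¹ * 3 ^ n * C * X.extNorm f := by
    calc _ = 2 * (3 ^ n * C) * X.extNorm T := by ring
      _ ≤ X.extNorm (ballLocMax t T) := hφ T hT
      _ ≤ X.extNorm (fun x => 3 ^ n * ballMax T x + t⁻¹ * 3 ^ n * ballMax f x) :=
          hX.extNorm_mono (measurable_ballLocMax _ _).aemeasurable <| .of_forall fun x =>
            ballLocMax_ballSum_le s c r hr hE hd hEB f ht ht' x
      _ ≤ X.extNorm (fun x => 3 ^ n * ballMax T x) +
          X.extNorm (fun x => t⁻¹ * 3 ^ n * ballMax f x) := hX.extNorm_add_le _ _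
      _ ≤ 3 ^ n * X.extNorm (ballMax T) + t⁻¹ * 3 ^ n * X.extNorm (ballMax f) :=
          add_le_add (hX.extNorm_const_mul_le h3 (hX.extNorm_ballMax_ne_top hM hT))
            (hX.extNorm_const_mul_le ht3 (hX.extNorm_ballMax_ne_top hM hf))
      _ ≤ 3 ^ n * (C * X.extNorm T) + t⁻¹ * 3 ^ n * (C * X.extNorm f) := by
          gcongr
          · exact hMC T
          · exact hMC f
      _ = _ := by ring
  -- Cancellation is legitimate because a finite sum of multiples of ball indicators has finite
  -- norm.
  have h := (ENNReal.add_le_add_iff_left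
    (ENNReal.mul_ne_top (ENNReal.mul_ne_top h3 hC) hT)).1 hmain
  refine le_trans ?_ h
  have h1 : (1 : ℝ≥0∞) ≤ 3 ^ n * C := one_le_mul (one_le_pow₀ (by norm_num)) hC1
  calc X.extNorm T = 1 * X.extNorm T := (one_mul _).symm
    _ ≤ _ := by gcongr

/-- Pairing `f` with a finite supremum of averages of `g` is at most pairing the adjoint sum of `f`
with `g`. Hölder and the uniform bound on adjoint sums apply, and monotone convergence removes
finiteness. -/
theorem IsBanachFunctionSpace.dualNorm_ballMax_le (hX : X.IsBanachFunctionSpace)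
    (hM : X.MaximalBounded) {C : ℝ≥0∞} (hC1 : 1 ≤ C) (hC : C ≠ ∞)
    (hMC : ∀ u, X.extNorm (ballMax u) ≤ C * X.extNorm u) {t : ℝ≥0∞} (ht : t ≠ 0) (ht' : t ≠ ∞)
    (hφ : ∀ u, X.extNorm u ≠ ∞ → 2 * (3 ^ n * C) * X.extNorm u ≤ X.extNorm (ballLocMax t u))
    {g : (Fin n → ℝ) → ℝ≥0∞} (hg : Measurable g) :
    X.dualNorm (ballMax g) ≤ 3 ^ n * (t⁻¹ * 3 ^ n * C) * X.dualNorm g := by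
  refine iSup₂_le fun h hh => ?_
  set f : (Fin n → ℝ) → ℝ≥0∞ := fun x => ‖(h : LZero n 𝕜) x‖ₑ
  have hfm : Measurable f := (h : LZero n 𝕜).stronglyMeasurable.enorm
  have hfN : X.extNorm f = ENNReal.ofReal (X.norm h) := hX.extNorm_eq (.of_forall fun _ => rfl)
  have hf : X.extNorm f ≠ ∞ := by
    rw [hfN]
    exact ENNReal.ofReal_ne_top
  have hf1 : X.extNorm f ≤ 1 := by
    rw [hfN]
    exact ENNReal.ofReal_le_one.2 hh
  obtain ⟨c, r, hr, hcr⟩ := exists_countable_balls n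
  let B : ℕ → Set (Fin n → ℝ) := fun k => closedBall (c k) (r k)
  have hB (k : ℕ) : MeasurableSet (B k) := isClosed_closedBall.measurableSet
  let a : ℕ → ℝ≥0∞ := fun k => (volume (B k))⁻¹ * ∫⁻ y in B k, g y
  let σ : ℕ → (Fin n → ℝ) → ℝ≥0∞ := fun m x =>
    (Finset.range m).sup fun k => a k * (B k).indicator 1 x
  have hσm (m : ℕ) : Measurable (σ m) := by
    simp only [σ, Finset.sup_eq_iSup]
    exact Measurable.iSup fun k => Measurable.iSup fun _ =>
      (measurable_one.indicator (hB k)).const_mul _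
  have hσmono : Monotone σ := fun i j hij x => Finset.sup_mono (Finset.range_mono hij)
  have hMg : ∀ x, ballMax g x ≤ 3 ^ n * ⨆ m, σ m x := by
    refine fun x => (hcr g x).trans (mul_le_mul_right (iSup_le fun k => ?_) _)
    refine le_iSup_of_le (k + 1) ?_
    exact Finset.le_sup (f := fun k => a k * (B k).indicator 1 x) (Finset.self_mem_range_succ k)
  have hstep (m : ℕ) : ∫⁻ x, f x * σ m x ≤ t⁻¹ * 3 ^ n * C * X.dualNorm g := by
    obtain ⟨E, hE, hd, hEB, hle⟩ := exists_disjoint_sup_le hB a m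
    have hTN := hX.extNorm_ballSum_le hM hC1 hC hMC ht ht' hφ (Finset.range m) c r hr hE hd hEB hf
    have hT := hX.extNorm_ballSum_ne_top hM (Finset.range m) c r hr hEB hf
    calc ∫⁻ x, f x * σ m x
        ≤ ∫⁻ x, ∑ k ∈ Finset.range m, a k * (E k).indicator f x := by
          refine lintegral_mono fun x => (mul_le_mul_right (hle x) (f x)).trans (le_of_eq ?_)
          rw [Finset.mul_sum]
          refine Finset.sum_congr rfl fun k _ => ?_
          by_cases hx : x ∈ E k
          · rw [Set.indicator_of_mem hx, Set.indicator_of_mem hx, Pi.one_apply, mul_one, mul_comm]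
          · simp only [Set.indicator_of_notMem hx, mul_zero]
      _ = ∑ k ∈ Finset.range m, a k * ∫⁻ x in E k, f x := by
          rw [lintegral_finsetSum _ fun k _ => (hfm.indicator (hE k)).const_mul _]
          refine Finset.sum_congr rfl fun k _ => ?_
          rw [lintegral_const_mul _ (hfm.indicator (hE k)), lintegral_indicator (hE k)]
      _ = ∫⁻ x, ballSum (Finset.range m) c r E f x * g x :=
          (lintegral_mul_ballSum _ c r E f hg).symm
      _ ≤ X.extNorm (ballSum (Finset.range m) c r E f) * X.dualNorm g := hX.lintegral_mul_le hT g
      _ ≤ t⁻¹ * 3 ^ n * C * 1 * X.dualNorm g := by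
          gcongr
          exact hTN.trans (by gcongr)
      _ = _ := by rw [mul_one]
  calc ∫⁻ x, f x * ballMax g x ≤ ∫⁻ x, 3 ^ n * ⨆ m, f x * σ m x := by
        refine lintegral_mono fun x => ?_
        rw [← ENNReal.mul_iSup, mul_left_comm]
        exact mul_le_mul_right (hMg x) _
    _ = 3 ^ n * ⨆ m, ∫⁻ x, f x * σ m x := by
        rw [lintegral_const_mul' _ _ (by simp), lintegral_iSup (f := fun m x => f x * σ m x)
          fun m => hfm.mul (hσm m)]
        exact fun i j hij x => mul_le_mul_right (hσmono hij x) _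
    _ ≤ 3 ^ n * (t⁻¹ * 3 ^ n * C * X.dualNorm g) := by
        gcongr
        exact iSup_le hstep
    _ = _ := by ring

theorem associate_norm_apply (f : X.associate.carrier) :
    ENNReal.ofReal (X.associate.norm f) = X.assocENorm f :=
  ENNReal.ofReal_toReal (ne_of_lt f.2)

theorem IsBanachFunctionSpace.maximalBounded_associate (hX : X.IsBanachFunctionSpace)
    (hM : X.MaximalBounded) {A : ℝ≥0∞} (hA : A ≠ ∞)
    (h : ∀ g, Measurable g → X.dualNorm (ballMax g) ≤ A * X.dualNorm g) :
    X.associate.MaximalBounded := by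
  refine ⟨A.toNNReal, fun f => ?_⟩
  rw [ENNReal.coe_toNNReal hA, associate_norm_apply, hlMaximal_eq_ballMax]
  set g : (Fin n → ℝ) → ℝ≥0∞ := fun x => ‖(f : LZero n 𝕜) x‖ₑ
  have hg : Measurable g := (f : LZero n 𝕜).stronglyMeasurable.enorm
  have hfg : X.assocENorm f = X.dualNorm g := assocENorm_eq_dualNorm (.of_forall fun _ => rfl)
  have hf : X.dualNorm g ≠ ∞ := hfg ▸ ne_of_lt f.2
  have hD : X.dualNorm (ballMax g) ≠ ∞ :=
    ne_top_of_le_ne_top (ENNReal.mul_ne_top hA hf) (h g hg)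
  obtain ⟨k, hk⟩ := exists_lzero_enorm_eq 𝕜 (measurable_ballMax g).aemeasurable
    (hX.ae_ne_top_of_dualNorm_ne_top hM (measurable_ballMax g) hD)
  have hkD := assocENorm_eq_dualNorm (X := X) hk
  have hkX : k ∈ X.associate.carrier := by
    change X.assocENorm k < ∞
    rw [hkD]
    exact hD.lt_top
  calc X.associate.extNorm (ballMax g) ≤ ENNReal.ofReal (X.associate.norm ⟨k, hkX⟩) :=
        iInf₂_le (⟨k, hkX⟩ : X.associate.carrier) hk
    _ = X.dualNorm (ballMax g) := (associate_norm_apply _).trans hkD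
    _ ≤ _ := by
        rw [hfg]
        exact h g hg

theorem IsBanachFunctionSpace.exists_dualNorm_ballMax_le (hX : X.IsBanachFunctionSpace)
    (hM : X.MaximalBounded) (hM' : X.associate.MaximalBounded) :
    ∃ C : ℝ≥0∞, C ≠ ∞ ∧ ∀ g, Measurable g → X.dualNorm g ≠ ∞ →
      X.dualNorm (ballMax g) ≤ C * X.dualNorm g := by
  obtain ⟨C, hC⟩ := hM'
  refine ⟨C, ENNReal.coe_ne_top, fun g hg hD => ?_⟩
  obtain ⟨f, hf⟩ := exists_lzero_enorm_eq 𝕜 hg.aemeasurable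
    (hX.ae_ne_top_of_dualNorm_ne_top hM hg hD)
  have hfD := assocENorm_eq_dualNorm (X := X) hf
  have hfX : f ∈ X.associate.carrier := by
    change X.assocENorm f < ∞
    rw [hfD]
    exact hD.lt_top
  have h := hC ⟨f, hfX⟩
  rw [associate_norm_apply, hlMaximal_eq_ballMax, ← ballMax_congr_ae hf] at h
  refine le_trans (le_iInf₂ fun k hk => ?_) (h.trans_eq (by rw [hfD]))
  rw [associate_norm_apply, ← assocENorm_eq_dualNorm hk]

theorem IsBanachFunctionSpace.exists_pow_mul_extNorm_le (hX : X.IsBanachFunctionSpace)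
    {κ t : ℝ≥0∞} (ht0 : t ≠ 0) (ht1 : t < 1)
    (h : ∀ u, X.extNorm u ≠ ∞ → κ * X.extNorm u ≤ X.extNorm (ballLocMax t u)) (k : ℕ) :
    ∃ t', t' ≠ 0 ∧ t' < 1 ∧ ∀ u, X.extNorm u ≠ ∞ →
      κ ^ 2 ^ k * X.extNorm u ≤ X.extNorm (ballLocMax t' u) := by
  induction k with
  | zero => exact ⟨t, ht0, ht1, by simpa using h⟩
  | succ k ih =>
    obtain ⟨s, hs0, hs1, hs⟩ := ih
    have hle : s * s * (15 ^ n)⁻¹ ≤ s := by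
      calc s * s * (15 ^ n)⁻¹ ≤ s * 1 * 1 := by
            gcongr
            exact ENNReal.inv_le_one.2 (one_le_pow₀ (by norm_num))
        _ = s := by ring
    refine ⟨s * s * (15 ^ n)⁻¹, mul_ne_zero (mul_ne_zero hs0 hs0) (by simp),
      hle.trans_lt hs1, fun u hu => ?_⟩
    -- The induction hypothesis is applied a second time to `ballLocMax s u`, which requires finite
    -- norm; if the norm is infinite, monotonicity in the parameter suffices.
    by_cases hm : X.extNorm (ballLocMax s u) = ∞
    · have := hX.extNorm_mono (measurable_ballLocMax s u).aemeasurable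
        (.of_forall (ballLocMax_anti hle u))
      rw [hm, top_le_iff] at this
      rw [this]
      exact le_top
    · calc κ ^ 2 ^ (k + 1) * X.extNorm u = κ ^ 2 ^ k * (κ ^ 2 ^ k * X.extNorm u) := by
            rw [← mul_assoc, ← pow_add, pow_succ, mul_two]
        _ ≤ κ ^ 2 ^ k * X.extNorm (ballLocMax s u) := by
            gcongr
            exact hs u hu
        _ ≤ X.extNorm (ballLocMax s (ballLocMax s u)) := hs _ hm
        _ ≤ _ := hX.extNorm_mono (measurable_ballLocMax _ _).aemeasurable
            (.of_forall (ballLocMax_ballLocMax_le hs0 hs1.le u))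

theorem exists_lt_pow_two_pow {κ : ℝ≥0∞} (hκ : 1 < κ) {C : ℝ≥0∞} (hC : C ≠ ∞) :
    ∃ k : ℕ, C < κ ^ 2 ^ k := by
  obtain ⟨κ', hκ1, hκ2⟩ := ENNReal.lt_iff_exists_nnreal_btwn.1 hκ
  lift C to ℝ≥0 using hC
  obtain ⟨k, hk⟩ := pow_unbounded_of_one_lt C (by exact_mod_cast hκ1)
  refine ⟨k, lt_of_lt_of_le (b := (κ' : ℝ≥0∞) ^ k) (by exact_mod_cast hk) ?_⟩
  calc (κ' : ℝ≥0∞) ^ k ≤ (κ' : ℝ≥0∞) ^ 2 ^ k := pow_le_pow_right₀ hκ1.le k.lt_two_pow_self.le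
    _ ≤ _ := by gcongr

theorem IsBanachFunctionSpace.phi_unbounded_of_one_lt (hX : X.IsBanachFunctionSpace) {lam : ℝ}
    (hlam : lam ∈ Set.Ioo (0 : ℝ) 1) (h : 1 < X.phi lam) (C : ℝ≥0) :
    ∃ lam ∈ Set.Ioo (0 : ℝ) 1, (C : ℝ≥0∞) < X.phi lam := by
  obtain ⟨κ, hκ1, hκ2⟩ := ENNReal.lt_iff_exists_nnreal_btwn.1 h
  obtain ⟨k, hk⟩ := exists_lt_pow_two_pow hκ1 (C := C) ENNReal.coe_ne_top
  obtain ⟨t, ht0, ht1, ht⟩ := hX.exists_pow_mul_extNorm_le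
    (ENNReal.ofReal_pos.2 hlam.1).ne' (ENNReal.ofReal_lt_one.2 hlam.2)
    (fun u hu => hX.mul_extNorm_le_of_lt_phi hκ2.le hu) k
  have htt : t ≠ ∞ := (ht1.trans ENNReal.one_lt_top).ne
  refine ⟨t.toReal, ⟨ENNReal.toReal_pos ht0 htt, ?_⟩, hk.trans_le (hX.le_phi fun u _ hu => ?_)⟩
  · rwa [← ENNReal.ofReal_lt_one, ENNReal.ofReal_toReal htt]
  · have := ht u (by simp [hu])
    rwa [hu, mul_one, ← ENNReal.ofReal_toReal htt] at this

theorem IsBanachFunctionSpace.maximalBounded_associate_of_phi_unbounded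
    (hX : X.IsBanachFunctionSpace) (hM : X.MaximalBounded)
    (h : ∀ C : ℝ≥0, ∃ lam ∈ Set.Ioo (0 : ℝ) 1, (C : ℝ≥0∞) < X.phi lam) :
    X.associate.MaximalBounded := by
  obtain ⟨C, hC1, hC, hMC⟩ := hX.exists_extNorm_ballMax_le hM
  have h3 : 2 * (3 ^ n * C) ≠ ∞ :=
    ENNReal.mul_ne_top (by simp) (ENNReal.mul_ne_top (by simp) hC)
  obtain ⟨lam, hlam, hφ⟩ := h (2 * (3 ^ n * C)).toNNReal
  rw [ENNReal.coe_toNNReal h3] at hφ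
  have ht0 : ENNReal.ofReal lam ≠ 0 := (ENNReal.ofReal_pos.2 hlam.1).ne'
  refine hX.maximalBounded_associate hM (A := 3 ^ n * ((ENNReal.ofReal lam)⁻¹ * 3 ^ n * C)) ?_
    fun g hg => hX.dualNorm_ballMax_le hM hC1 hC hMC ht0 ENNReal.ofReal_ne_top
      (fun u hu => hX.mul_extNorm_le_of_lt_phi hφ.le hu) hg
  exact ENNReal.mul_ne_top (by simp) (ENNReal.mul_ne_top (ENNReal.mul_ne_top
    (ENNReal.inv_ne_top.2 ht0) (by simp)) hC)

end FunctionSpace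

/-! ### Truncation into L² -/

section Truncation

open Metric

variable {n : ℕ}

/-- The truncation of a `[0, ∞]`-valued function in height and in space. -/
noncomputable def truncate (u : (Fin n → ℝ) → ℝ≥0∞) (k : ℕ) : (Fin n → ℝ) → ℝ≥0∞ :=
  (closedBall 0 k).indicator fun x => min (u x) k

theorem measurable_truncate {u : (Fin n → ℝ) → ℝ≥0∞} (hu : Measurable u) (k : ℕ) :
    Measurable (truncate u k) :=
  (hu.min measurable_const).indicator isClosed_closedBall.measurableSet

theorem truncate_le (u : (Fin n → ℝ) → ℝ≥0∞) (k : ℕ) : truncate u k ≤ u :=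
  fun _ => (Set.indicator_le_self' (fun _ _ => zero_le) _).trans (min_le_left _ _)

theorem truncate_le_indicator (u : (Fin n → ℝ) → ℝ≥0∞) (k : ℕ) (x : Fin n → ℝ) :
    truncate u k x ≤ (closedBall 0 k).indicator (fun _ => (k : ℝ≥0∞)) x :=
  Set.indicator_le_indicator (min_le_right _ _)

theorem truncate_ne_top (u : (Fin n → ℝ) → ℝ≥0∞) (k : ℕ) (x : Fin n → ℝ) :
    truncate u k x ≠ ∞ := by
  refine ne_top_of_le_ne_top (ENNReal.natCast_ne_top k) ((truncate_le_indicator u k x).trans ?_)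
  exact Set.indicator_le_self' (fun _ _ => zero_le) _

theorem monotone_truncate (u : (Fin n → ℝ) → ℝ≥0∞) : Monotone (truncate u) := by
  intro i j hij x
  refine (Set.indicator_le_indicator_of_subset (closedBall_subset_closedBall
    (Nat.cast_le.2 hij)) (fun _ => zero_le) x).trans (Set.indicator_le_indicator ?_)
  gcongr

theorem iSup_truncate (u : (Fin n → ℝ) → ℝ≥0∞) (x : Fin n → ℝ) :
    ⨆ k, truncate u k x = u x := by
  refine le_antisymm (iSup_le fun k => truncate_le u k x) (le_of_forall_lt fun β hβ => ?_)
  obtain ⟨k, hk⟩ := ENNReal.exists_nat_gt hβ.ne_top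
  obtain ⟨m, hm⟩ := exists_nat_ge (dist x 0)
  rw [lt_iSup_iff]
  refine ⟨max k m, ?_⟩
  have hx : x ∈ closedBall (0 : Fin n → ℝ) ((max k m : ℕ) : ℝ) :=
    hm.trans (Nat.cast_le.2 (le_max_right k m))
  rw [truncate, Set.indicator_of_mem hx]
  exact lt_min hβ (hk.trans_le (Nat.cast_le.2 (le_max_left k m)))

theorem memLp_two_of_enorm_le_truncate {𝕜 : Type*} [RCLike 𝕜] {f : (Fin n → ℝ) → 𝕜}
    (hf : AEStronglyMeasurable f) {u : (Fin n → ℝ) → ℝ≥0∞} {k : ℕ}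
    (h : ∀ x, ‖f x‖ₑ ≤ truncate u k x) : MemLp f 2 volume := by
  have hi : MemLp ((closedBall (0 : Fin n → ℝ) k).indicator fun _ => (k : ℝ)) 2 volume :=
    memLp_indicator_const 2 isClosed_closedBall.measurableSet _
      (Or.inr (volume_closedBall_ne_top _ _))
  refine hi.mono hf (.of_forall fun x => ?_)
  rw [← enorm_le_iff_norm_le]
  refine ((h x).trans (truncate_le_indicator u k x)).trans_eq ?_
  by_cases hx : x ∈ closedBall (0 : Fin n → ℝ) k
  · rw [Set.indicator_of_mem hx, Set.indicator_of_mem hx, ← ofReal_norm, Real.norm_natCast,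
      ENNReal.ofReal_natCast]
  · rw [Set.indicator_of_notMem hx, Set.indicator_of_notMem hx, enorm_zero]

end Truncation

/-! ### The Lorentz–Luxemburg theorem via Hahn–Banach in L² -/

namespace FunctionSpace

open Metric

variable {n : ℕ} {𝕜 : Type*} [RCLike 𝕜] {X : FunctionSpace n 𝕜}

/-- The infima over tails increase to the limit, so the monotone Fatou property applies to them. -/
theorem IsBanachFunctionSpace.extNorm_enorm_le_of_tendsto (hX : X.IsBanachFunctionSpace)
    {f : ℕ → (Fin n → ℝ) → 𝕜} {F : (Fin n → ℝ) → 𝕜}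
    (hlim : ∀ᵐ x, Tendsto (fun j => f j x) atTop (𝓝 (F x))) {a : ℝ≥0∞} (ha : a ≠ ∞)
    (hf : ∀ j, X.extNorm (fun x => ‖f j x‖ₑ) ≤ a) : X.extNorm (fun x => ‖F x‖ₑ) ≤ a := by
  let v : ℕ → (Fin n → ℝ) → ℝ≥0∞ := fun k x => ⨅ j, ‖f (k + j) x‖ₑ
  have hfm (j : ℕ) : AEMeasurable fun x => ‖f j x‖ₑ :=
    aemeasurable_of_extNorm_ne_top (ne_top_of_le_ne_top ha (hf j))
  have hvF : (fun x => ⨆ k, v k x) =ᵐ[volume] fun x => ‖F x‖ₑ := by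
    filter_upwards [hlim] with x hx
    have h1 := ((continuous_enorm.tendsto _).comp hx).liminf_eq
    rw [← h1, liminf_eq_iSup_iInf_of_nat']
    simp only [v, Function.comp_apply, add_comm]
  rw [← extNorm_congr hvF]
  refine hX.extNorm_iSup_le (fun i j hij x => ?_) ?_ ha fun k => ?_
  · refine le_iInf fun m => iInf_le_of_le (j - i + m) ?_
    rw [← add_assoc, Nat.add_sub_cancel' hij]
  · filter_upwards [hvF] with x hx
    rw [hx]
    exact enorm_ne_top
  · refine (hX.extNorm_mono (AEMeasurable.iInf fun j => hfm (k + j)) ?_).trans (hf k)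
    exact .of_forall fun x => iInf_le_of_le 0 (by rw [add_zero])

theorem IsBanachFunctionSpace.isClosed_extNorm_le_one (hX : X.IsBanachFunctionSpace) :
    IsClosed {f : Lp 𝕜 2 (volume : Measure (Fin n → ℝ)) | X.extNorm (fun x => ‖f x‖ₑ) ≤ 1} := by
  refine IsSeqClosed.isClosed fun f F hf hlim => ?_
  obtain ⟨ns, -, hns⟩ := (tendstoInMeasure_of_tendsto_Lp hlim).exists_seq_tendsto_ae
  exact hX.extNorm_enorm_le_of_tendsto hns ENNReal.one_ne_top fun j => hf (ns j)

theorem IsBanachFunctionSpace.convex_extNorm_le_one (hX : X.IsBanachFunctionSpace) :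
    Convex ℝ {f : Lp 𝕜 2 (volume : Measure (Fin n → ℝ)) | X.extNorm (fun x => ‖f x‖ₑ) ≤ 1} := by
  intro f hf g hg a b ha hb hab
  have hf' : X.extNorm (fun x => ‖f x‖ₑ) ≠ ∞ := ne_top_of_le_ne_top ENNReal.one_ne_top hf
  have hg' : X.extNorm (fun x => ‖g x‖ₑ) ≠ ∞ := ne_top_of_le_ne_top ENNReal.one_ne_top hg
  calc X.extNorm (fun x => ‖(a • f + b • g : Lp 𝕜 2 (volume : Measure (Fin n → ℝ))) x‖ₑ)
      ≤ X.extNorm (fun x => ENNReal.ofReal a * ‖f x‖ₑ + ENNReal.ofReal b * ‖g x‖ₑ) := by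
        refine hX.extNorm_mono (Lp.aestronglyMeasurable _).enorm ?_
        filter_upwards [Lp.coeFn_add (a • f) (b • g), Lp.coeFn_smul a f, Lp.coeFn_smul b g]
          with x h1 h2 h3
        rw [h1, Pi.add_apply, h2, h3, Pi.smul_apply, Pi.smul_apply]
        refine (enorm_add_le _ _).trans_eq ?_
        rw [enorm_smul, enorm_smul, Real.enorm_of_nonneg ha, Real.enorm_of_nonneg hb]
    _ ≤ ENNReal.ofReal a * X.extNorm (fun x => ‖f x‖ₑ) +
          ENNReal.ofReal b * X.extNorm (fun x => ‖g x‖ₑ) :=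
        (hX.extNorm_add_le _ _).trans (add_le_add
          (hX.extNorm_const_mul_le ENNReal.ofReal_ne_top hf')
          (hX.extNorm_const_mul_le ENNReal.ofReal_ne_top hg'))
    _ ≤ ENNReal.ofReal a * 1 + ENNReal.ofReal b * 1 := by
        gcongr
        · exact hf
        · exact hg
    _ = 1 := by
        rw [mul_one, mul_one, ← ENNReal.ofReal_add ha hb, hab, ENNReal.ofReal_one]

theorem inner_ofReal_mul_div_norm (r : ℝ) (z : 𝕜) :
    inner 𝕜 z ((r : 𝕜) * (z / (‖z‖ : 𝕜))) = ((r * ‖z‖ : ℝ) : 𝕜) := by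
  rcases eq_or_ne z 0 with rfl | hz
  · simp
  · have hz' : (‖z‖ : 𝕜) ≠ 0 := RCLike.ofReal_ne_zero.2 (norm_ne_zero_iff.2 hz)
    rw [RCLike.inner_apply, RCLike.ofReal_mul]
    calc _ = (r : 𝕜) * (z * (starRingEnd 𝕜) z) / (‖z‖ : 𝕜) := by ring
      _ = _ := by
        rw [RCLike.mul_conj]
        field_simp

/-- A functional on `L²` which is bounded on the unit ball of `X` is represented by an element of
the associate space. -/
theorem IsBanachFunctionSpace.lintegral_mul_le_of_inner_lt (hX : X.IsBanachFunctionSpace)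
    (g : Lp 𝕜 2 (volume : Measure (Fin n → ℝ))) {s : ℝ}
    (hg : ∀ f : Lp 𝕜 2 (volume : Measure (Fin n → ℝ)), X.extNorm (fun x => ‖f x‖ₑ) ≤ 1 →
      RCLike.re (inner 𝕜 g f) < s) {u : (Fin n → ℝ) → ℝ≥0∞} (hu : Measurable u)
    (hu1 : X.extNorm u ≤ 1) : ∫⁻ x, u x * ‖g x‖ₑ ≤ ENNReal.ofReal s := by
  have hgm : Measurable g := (Lp.stronglyMeasurable g).measurable
  have hstep (k : ℕ) : ∫⁻ x, truncate u k x * ‖g x‖ₑ ≤ ENNReal.ofReal s := by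
    -- The test function has modulus at most the truncation of `u` and the phase of `g`, so its
    -- inner product with `g` is the integral of the truncation against `|g|`.
    let b : (Fin n → ℝ) → 𝕜 := fun x => (((truncate u k x).toReal : ℝ) : 𝕜) *
      (g x / ((‖g x‖ : ℝ) : 𝕜))
    have hbm : Measurable b :=
      (RCLike.measurable_ofReal.comp (measurable_truncate hu k).ennreal_toReal).mul
        (hgm.div (RCLike.measurable_ofReal.comp hgm.norm))
    have hble (x : Fin n → ℝ) : ‖b x‖ₑ ≤ truncate u k x := by
      rw [enorm_mul, enorm_ofReal_toReal (truncate_ne_top u k x)]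
      refine mul_le_of_le_one_right zero_le ?_
      rw [← ofReal_norm, ENNReal.ofReal_le_one, norm_div, RCLike.norm_ofReal, abs_norm]
      exact div_self_le_one _
    have hb : MemLp b 2 volume := memLp_two_of_enorm_le_truncate hbm.aestronglyMeasurable hble
    have hbN : X.extNorm (fun x => ‖hb.toLp b x‖ₑ) ≤ 1 := by
      refine (hX.extNorm_mono (Lp.aestronglyMeasurable _).enorm ?_).trans hu1
      filter_upwards [hb.coeFn_toLp] with x hx
      rw [hx]
      exact (hble x).trans (truncate_le u k x)
    have hlt := hg _ hbN
    rw [L2.inner_def, ← integral_re (L2.integrable_inner _ _)] at hlt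
    have hae : ∀ᵐ x, RCLike.re (inner 𝕜 (g x) (hb.toLp b x)) =
        (truncate u k x).toReal * ‖g x‖ := by
      filter_upwards [hb.coeFn_toLp] with x hx
      rw [hx, inner_ofReal_mul_div_norm, RCLike.ofReal_re]
    have hint : Integrable (fun x => (truncate u k x).toReal * ‖g x‖) :=
      (L2.integrable_inner g (hb.toLp b)).re.congr hae
    rw [integral_congr_ae hae] at hlt
    calc ∫⁻ x, truncate u k x * ‖g x‖ₑ
        = ∫⁻ x, ENNReal.ofReal ((truncate u k x).toReal * ‖g x‖) := by
          refine lintegral_congr fun x => ?_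
          rw [ENNReal.ofReal_mul ENNReal.toReal_nonneg, ENNReal.ofReal_toReal
            (truncate_ne_top u k x), ofReal_norm]
      _ = ENNReal.ofReal (∫ x, (truncate u k x).toReal * ‖g x‖) :=
          (ofReal_integral_eq_lintegral_ofReal hint
            (.of_forall fun x => by positivity)).symm
      _ ≤ _ := ENNReal.ofReal_le_ofReal hlt.le
  calc ∫⁻ x, u x * ‖g x‖ₑ = ∫⁻ x, ⨆ k, truncate u k x * ‖g x‖ₑ := by
        refine lintegral_congr fun x => ?_
        rw [← ENNReal.iSup_mul, iSup_truncate]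
    _ = ⨆ k, ∫⁻ x, truncate u k x * ‖g x‖ₑ := by
        refine lintegral_iSup (fun k => (measurable_truncate hu k).mul hgm.enorm) ?_
        exact fun i j hij x => mul_le_mul_left (monotone_truncate u hij x) _
    _ ≤ _ := iSup_le hstep

/-- The nontrivial half of the Lorentz–Luxemburg theorem `X'' = X`. -/
theorem IsBanachFunctionSpace.exists_one_le_lintegral_mul (hX : X.IsBanachFunctionSpace)
    {u : (Fin n → ℝ) → ℝ≥0∞} (hu : Measurable u) (hu1 : 1 < X.extNorm u)
    (huX : X.extNorm u ≠ ∞) :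
    ∃ g, Measurable g ∧ X.dualNorm g ≤ 1 ∧ 1 ≤ ∫⁻ x, u x * g x := by
  -- By Fatou some truncation already has norm above `1`; unlike `u`, it is known to lie in `L²`,
  -- where Hahn–Banach and Riesz representation are available.
  obtain ⟨k, hk⟩ : ∃ k, 1 < X.extNorm (truncate u k) := by
    by_contra! h
    refine hu1.not_ge ?_
    have := hX.extNorm_iSup_le (monotone_truncate u) (by
      simp only [iSup_truncate]
      exact ae_ne_top_of_extNorm_ne_top huX) ENNReal.one_ne_top h
    simpa only [iSup_truncate] using this
  let f : (Fin n → ℝ) → 𝕜 := fun x => ((truncate u k x).toReal : 𝕜)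
  have hfe (x : Fin n → ℝ) : ‖f x‖ₑ = truncate u k x :=
    enorm_ofReal_toReal (truncate_ne_top u k x)
  have hfm : Measurable f :=
    RCLike.measurable_ofReal.comp (measurable_truncate hu k).ennreal_toReal
  have hf : MemLp f 2 volume :=
    memLp_two_of_enorm_le_truncate hfm.aestronglyMeasurable fun x => (hfe x).le
  have hfF : ∀ᵐ x, ‖hf.toLp f x‖ₑ = truncate u k x := by
    filter_upwards [hf.coeFn_toLp] with x hx
    rw [hx, hfe]
  have hnot : hf.toLp f ∉ {f : Lp 𝕜 2 (volume : Measure (Fin n → ℝ)) |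
      X.extNorm (fun x => ‖f x‖ₑ) ≤ 1} := by
    rw [Set.mem_ofPred_eq, extNorm_congr hfF, not_le]
    exact hk
  obtain ⟨φ, s, hφ1, hφ2⟩ := RCLike.geometric_hahn_banach_closed_point (𝕜 := 𝕜)
    hX.convex_extNorm_le_one hX.isClosed_extNorm_le_one hnot
  set g := (InnerProductSpace.toDual 𝕜 (Lp 𝕜 2 (volume : Measure (Fin n → ℝ)))).symm φ
  have hgφ (v : Lp 𝕜 2 (volume : Measure (Fin n → ℝ))) : inner 𝕜 g v = φ v :=
    InnerProductSpace.toDual_symm_apply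
  -- The unit ball contains `0`, so the separating level is positive and `g` may be normalized by
  -- it.
  have hs : 0 < s := by
    have h0 : X.extNorm (fun x => ‖(0 : Lp 𝕜 2 (volume : Measure (Fin n → ℝ))) x‖ₑ) ≤ 1 := by
      rw [extNorm_congr (v := fun _ => 0), hX.extNorm_zero]
      · exact zero_le_one
      · filter_upwards [Lp.coeFn_zero 𝕜 2 (volume : Measure (Fin n → ℝ))] with x hx
        rw [hx, Pi.zero_apply, enorm_zero]
    simpa using hφ1 0 h0
  have hs0 : ENNReal.ofReal s ≠ 0 := (ENNReal.ofReal_pos.2 hs).ne'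
  have hs1 : ENNReal.ofReal s ≠ ∞ := ENNReal.ofReal_ne_top
  have hgm : Measurable fun x => ‖g x‖ₑ := (Lp.stronglyMeasurable g).enorm
  refine ⟨fun x => (ENNReal.ofReal s)⁻¹ * ‖g x‖ₑ, hgm.const_mul _, ?_, ?_⟩
  · refine iSup₂_le fun h hh => ?_
    have h1 := hX.lintegral_mul_le_of_inner_lt g (s := s) (fun v hv => by
      rw [hgφ]
      exact hφ1 v hv) (u := fun x => ‖(h : LZero n 𝕜) x‖ₑ)
      (h : LZero n 𝕜).stronglyMeasurable.enorm (by
        rw [hX.extNorm_eq (h := h) (.of_forall fun _ => rfl)]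
        exact ENNReal.ofReal_le_one.2 hh)
    simp only [mul_left_comm _ (ENNReal.ofReal s)⁻¹]
    rw [lintegral_const_mul' _ _ (ENNReal.inv_ne_top.2 hs0), ← ENNReal.inv_mul_cancel hs0 hs1]
    gcongr
  · have h1 : ENNReal.ofReal s ≤ ∫⁻ x, truncate u k x * ‖g x‖ₑ := by
      calc ENNReal.ofReal s ≤ ENNReal.ofReal ‖inner 𝕜 g (hf.toLp f)‖ := by
            refine ENNReal.ofReal_le_ofReal (hφ2.le.trans ?_)
            rw [hgφ]
            exact RCLike.re_le_norm _
        _ = ‖∫ x, inner 𝕜 (g x) (hf.toLp f x)‖ₑ := by rw [ofReal_norm, L2.inner_def]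
        _ ≤ ∫⁻ x, ‖inner 𝕜 (g x) (hf.toLp f x)‖ₑ := enorm_integral_le_lintegral_enorm _
        _ = ∫⁻ x, truncate u k x * ‖g x‖ₑ := by
            refine lintegral_congr_ae ?_
            filter_upwards [hfF] with x hx
            rw [RCLike.inner_apply, enorm_mul, hx, RCLike.enorm_conj]
    simp only [mul_left_comm _ (ENNReal.ofReal s)⁻¹]
    rw [lintegral_const_mul' _ _ (ENNReal.inv_ne_top.2 hs0), ← ENNReal.inv_mul_cancel hs0 hs1]
    gcongr
    refine h1.trans (lintegral_mono fun x => ?_)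
    gcongr
    exact truncate_le u k x

end FunctionSpace

/-! ### Amplifying the weighted gain -/

section Iteration

variable {n : ℕ}

/-- The order of quantifiers matters: `t` depends only on `n`, `K` and `k`, so one `t` serves all
weights with the same `A₁` constant. -/
theorem exists_pow_mul_lintegral_le (hn : 1 ≤ n) {K : ℝ≥0∞} (hK0 : K ≠ 0) (hK : K ≠ ∞) (k : ℕ) :
    ∃ t : ℝ≥0∞, t ≠ 0 ∧ t < 1 ∧ ∀ G : (Fin n → ℝ) → ℝ≥0∞, Measurable G →
      (∀ᵐ x, ballMax G x ≤ K * G x) → ∀ u, Measurable u →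
        (1 + (K * 2 * 5 ^ n)⁻¹) ^ 2 ^ k * ∫⁻ x, u x * G x ≤ ∫⁻ x, ballLocMax t u x * G x := by
  induction k with
  | zero =>
    have h2 : ((2 : ℝ≥0∞) ^ (n + 2))⁻¹ * 2 ^ (n + 1) < 1 := by
      rw [pow_succ _ (n + 1), ENNReal.mul_inv (by simp) (by simp), mul_right_comm,
        ENNReal.inv_mul_cancel (by simp) (by simp), one_mul]
      exact ENNReal.inv_lt_one.2 ENNReal.one_lt_two
    refine ⟨((2 : ℝ≥0∞) ^ (n + 2))⁻¹, by simp, ?_, fun G hG hGK u hu => ?_⟩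
    · exact ENNReal.inv_lt_one.2 (one_lt_pow₀ ENNReal.one_lt_two (by omega))
    · rw [pow_zero, pow_one]
      exact lintegral_mul_le_lintegral_ballLocMax_mul hn hG hK0 hK hGK h2 hu
  | succ k ih =>
    obtain ⟨t, ht0, ht1, h⟩ := ih
    have hle : t * t * (15 ^ n)⁻¹ ≤ t := by
      calc t * t * (15 ^ n)⁻¹ ≤ t * 1 * 1 := by
            gcongr
            exact ENNReal.inv_le_one.2 (one_le_pow₀ (by norm_num))
        _ = t := by ring
    refine ⟨t * t * (15 ^ n)⁻¹, mul_ne_zero (mul_ne_zero ht0 ht0) (by simp), hle.trans_lt ht1,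
      fun G hG hGK u hu => ?_⟩
    rw [pow_succ 2 k, mul_two (2 ^ k), pow_add, mul_assoc]
    refine (mul_le_mul_right (h G hG hGK u hu) _).trans ?_
    refine (h G hG hGK _ (measurable_ballLocMax t u)).trans (lintegral_mono fun x => ?_)
    exact mul_le_mul_left (ballLocMax_ballLocMax_le ht0 ht1.le u x) _

end Iteration

/-! ### Rubio de Francia majorants and the converse implication -/

namespace FunctionSpace

variable {n : ℕ} {𝕜 : Type*} [RCLike 𝕜] {X : FunctionSpace n 𝕜}

theorem measurable_iterate_ballMax {g : (Fin n → ℝ) → ℝ≥0∞} (hg : Measurable g) (k : ℕ) :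
    Measurable (ballMax^[k] g) := by
  cases k with
  | zero => exact hg
  | succ k =>
    rw [Function.iterate_succ_apply']
    exact measurable_ballMax _

/-- The Rubio de Francia algorithm: functions in the associate space have `A₁` majorants. -/
theorem exists_majorant_ballMax_le {C : ℝ≥0∞} (hC1 : 1 ≤ C) (hC : C ≠ ∞)
    (hD : ∀ g, Measurable g → X.dualNorm g ≠ ∞ → X.dualNorm (ballMax g) ≤ C * X.dualNorm g)
    {g : (Fin n → ℝ) → ℝ≥0∞} (hg : Measurable g) (hg1 : X.dualNorm g ≤ 1) :
    ∃ G, Measurable G ∧ g ≤ G ∧ X.dualNorm G ≤ 2 ∧ ∀ x, ballMax G x ≤ 2 * C * G x := by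
  have hC0 : C ≠ 0 := (zero_lt_one.trans_le hC1).ne'
  have hK0 : 2 * C ≠ 0 := mul_ne_zero two_ne_zero hC0
  have hK1 : 2 * C ≠ ∞ := ENNReal.mul_ne_top (by simp) hC
  have hm := measurable_iterate_ballMax hg
  have hiter (k : ℕ) : X.dualNorm (ballMax^[k] g) ≤ C ^ k := by
    induction k with
    | zero => simpa using hg1
    | succ k ih =>
      rw [Function.iterate_succ_apply', pow_succ']
      refine (hD _ (hm k) (ne_top_of_le_ne_top (ENNReal.pow_ne_top hC) ih)).trans ?_
      gcongr
  -- The weights `(2C)⁻ᵏ` make the norms summable to `2`, and applying `M` shifts the series by one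
  -- index at the cost of a factor `2C`.
  let T : ℕ → (Fin n → ℝ) → ℝ≥0∞ := fun k x => (2 * C)⁻¹ ^ k * ballMax^[k] g x
  have hT (k : ℕ) : Measurable (T k) := (hm k).const_mul _
  refine ⟨fun x => ∑' k, T k x, Measurable.tsum hT, fun x => ?_, ?_, fun x => ?_⟩
  · refine le_trans (le_of_eq ?_) (ENNReal.le_tsum 0)
    simp [T]
  · refine iSup₂_le fun h hh => ?_
    have hhm : Measurable fun x => ‖(h : LZero n 𝕜) x‖ₑ :=
      (h : LZero n 𝕜).stronglyMeasurable.enorm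
    calc ∫⁻ x, ‖(h : LZero n 𝕜) x‖ₑ * ∑' k, T k x
        = ∑' k, ∫⁻ x, ‖(h : LZero n 𝕜) x‖ₑ * T k x := by
          simp only [← ENNReal.tsum_mul_left]
          exact lintegral_tsum fun k => (hhm.mul (hT k)).aemeasurable
      _ ≤ ∑' k, (2 : ℝ≥0∞)⁻¹ ^ k := by
          refine ENNReal.tsum_le_tsum fun k => ?_
          simp only [T, mul_left_comm _ ((2 * C)⁻¹ ^ k)]
          rw [lintegral_const_mul' _ _ (ENNReal.pow_ne_top (ENNReal.inv_ne_top.2 hK0))]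
          have h1 : ∫⁻ x, ‖(h : LZero n 𝕜) x‖ₑ * ballMax^[k] g x ≤ C ^ k :=
            (le_iSup₂ (f := fun (h : X.carrier) (_ : X.norm h ≤ 1) =>
              ∫⁻ x, ‖(h : LZero n 𝕜) x‖ₑ * ballMax^[k] g x) h hh).trans (hiter k)
          refine (mul_le_mul_right h1 _).trans_eq ?_
          rw [← mul_pow, ENNReal.mul_inv (by simp) (by simp), mul_assoc,
            ENNReal.inv_mul_cancel hC0 hC, mul_one]
      _ = 2 := by rw [ENNReal.tsum_geometric, ENNReal.one_sub_inv_two, inv_inv]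
  · calc ballMax (fun y => ∑' k, T k y) x ≤ ∑' k, ballMax (T k) x := ballMax_tsum_le hT x
      _ ≤ ∑' k, 2 * C * T (k + 1) x := by
          refine ENNReal.tsum_le_tsum fun k => (ballMax_const_mul_le (hm k) _ x).trans_eq ?_
          simp only [T, pow_succ', Function.iterate_succ_apply']
          rw [← mul_assoc, ← mul_assoc, ENNReal.mul_inv_cancel hK0 hK1, one_mul]
      _ = 2 * C * ∑' k, T (k + 1) x := ENNReal.tsum_mul_left
      _ ≤ _ := by
          gcongr
          exact ENNReal.tsum_comp_le_tsum_of_injective (add_left_injective 1) _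

/-- All majorants share the `A₁` constant `2 * C`, so a single `t` works for every `u` of norm `1`,
as the infimum defining `φ_X` demands. -/
theorem IsBanachFunctionSpace.phi_unbounded_of_maximalBounded_associate
    (hX : X.IsBanachFunctionSpace) (hn : 1 ≤ n) (hM : X.MaximalBounded)
    (hM' : X.associate.MaximalBounded) (A : ℝ≥0) :
    ∃ lam ∈ Set.Ioo (0 : ℝ) 1, (A : ℝ≥0∞) < X.phi lam := by
  obtain ⟨C₀, hC₀, hD₀⟩ := hX.exists_dualNorm_ballMax_le hM hM'
  set C := C₀ + 1
  have hC1 : 1 ≤ C := le_add_self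
  have hC : C ≠ ∞ := ENNReal.add_ne_top.2 ⟨hC₀, ENNReal.one_ne_top⟩
  have hD (g) (hg : Measurable g) (hg' : X.dualNorm g ≠ ∞) :
      X.dualNorm (ballMax g) ≤ C * X.dualNorm g :=
    (hD₀ g hg hg').trans (mul_le_mul_left le_self_add _)
  have hK0 : 2 * C ≠ 0 := mul_ne_zero two_ne_zero (zero_lt_one.trans_le hC1).ne'
  have hK1 : 2 * C ≠ ∞ := ENNReal.mul_ne_top (by simp) hC
  set κ := 1 + (2 * C * 2 * 5 ^ n)⁻¹
  have hκ : 1 < κ := ENNReal.lt_add_right ENNReal.one_ne_top <| ENNReal.inv_ne_zero.2 <|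
    ENNReal.mul_ne_top (ENNReal.mul_ne_top hK1 (by simp)) (by simp)
  -- The `4` pays for two factors `2`: the norm of the majorant `G`, and the replacement of `u` by
  -- `2u`.
  obtain ⟨k, hk⟩ := exists_lt_pow_two_pow hκ (C := 4 * A)
    (ENNReal.mul_ne_top (by simp) ENNReal.coe_ne_top)
  obtain ⟨t, ht0, ht1, ht⟩ := exists_pow_mul_lintegral_le hn hK0 hK1 k
  have htt : t ≠ ∞ := (ht1.trans ENNReal.one_lt_top).ne
  refine ⟨t.toReal, ⟨ENNReal.toReal_pos ht0 htt, ?_⟩, ?_⟩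
  · rwa [← ENNReal.ofReal_lt_one, ENNReal.ofReal_toReal htt]
  have h4 : (A : ℝ≥0∞) < κ ^ 2 ^ k / 4 := by
    rwa [ENNReal.lt_div_iff_mul_lt (by simp) (by simp), mul_comm]
  refine h4.trans_le (hX.le_phi fun u hu hu1 => ?_)
  rw [ENNReal.ofReal_toReal htt]
  by_cases hm : X.extNorm (ballLocMax t u) = ∞
  · rw [hm]
    exact le_top
  have hu' : X.extNorm u ≠ ∞ := by simp [hu1]
  have h2u : X.extNorm (fun x => 2 * u x) ≠ ∞ :=
    ne_top_of_le_ne_top (ENNReal.mul_ne_top (by simp) hu') (hX.extNorm_const_mul_le (by simp) hu')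
  -- Separation needs norm strictly above `1`, hence the doubling of `u`.
  have h2u1 : 1 < X.extNorm (fun x => 2 * u x) := by
    have h := hX.extNorm_const_mul_le (a := 2⁻¹) (by simp) h2u
    simp only [← mul_assoc, ENNReal.inv_mul_cancel two_ne_zero ENNReal.ofNat_ne_top, one_mul,
      hu1] at h
    by_contra! hle
    have : (1 : ℝ≥0∞) ≤ 2⁻¹ * 1 := h.trans (by gcongr)
    rw [mul_one] at this
    exact this.not_gt (ENNReal.inv_lt_one.2 ENNReal.one_lt_two)
  obtain ⟨g, hg, hgD, hgu⟩ := hX.exists_one_le_lintegral_mul (hu.const_mul 2) h2u1 h2u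
  obtain ⟨G, hG, hgG, hGD, hGK⟩ := exists_majorant_ballMax_le hC1 hC hD hg hgD
  have hone : 1 ≤ 2 * ∫⁻ x, u x * G x := by
    rw [← lintegral_const_mul' _ _ (by simp)]
    refine hgu.trans (lintegral_mono fun x => ?_)
    simp only [mul_assoc]
    gcongr
    exact hgG x
  refine ENNReal.div_le_of_le_mul ?_
  calc κ ^ 2 ^ k = κ ^ 2 ^ k * 1 := (mul_one _).symm
    _ ≤ κ ^ 2 ^ k * (2 * ∫⁻ x, u x * G x) := by gcongr
    _ = 2 * (κ ^ 2 ^ k * ∫⁻ x, u x * G x) := by ring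
    _ ≤ 2 * ∫⁻ x, ballLocMax t u x * G x := by
        gcongr
        exact ht G hG (.of_forall hGK) u hu
    _ ≤ 2 * (X.extNorm (ballLocMax t u) * 2) := by
        gcongr
        exact (hX.lintegral_mul_le hm G).trans (by gcongr)
    _ = X.extNorm (ballLocMax t u) * 4 := by ring

end FunctionSpace

theorem theorem1p2 {n : ℕ} (hn : 1 ≤ n) {𝕜 : Type*} [RCLike 𝕜] (X : FunctionSpace n 𝕜)
    (hX : X.IsBanachFunctionSpace) (hM : X.MaximalBounded) :
    List.TFAE [
      X.associate.MaximalBounded,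
      ∀ C : ℝ≥0, ∃ lam ∈ Set.Ioo (0 : ℝ) 1, (C : ℝ≥0∞) < X.phi lam,
      ∃ lam ∈ Set.Ioo (0 : ℝ) 1, 1 < X.phi lam] := by
  tfae_have 1 → 2 := fun h => hX.phi_unbounded_of_maximalBounded_associate hn hM h
  tfae_have 2 → 1 := hX.maximalBounded_associate_of_phi_unbounded hM
  tfae_have 2 → 3 := fun h => by simpa using h 1
  tfae_have 3 → 2 := fun ⟨_, hlam, h⟩ => hX.phi_unbounded_of_one_lt hlam h
  tfae_finish
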